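/- **Setting.** Let $A,B$ be finite groups and $\kappa\ge 2$ an integer. For $m\in\mathbb N$ let $\Gamma_m$ be a finite group generated by the union of two subgroups $A_m=\{a_m: a\in A\}\cong A$ and $B_m=\{b_m:b\in B\}\cong B$, and let $(k_m)$ be a sequence in $\mathbb N\cup\{+\infty\}$ and $(l_m)$ a sequence of positive reals such that * $k_0=0$, $k_{m+1}\ge 2k_m$ for all $m$, and every finite $k_m$ with $m\ge1$ is a power $\kappa^j$, $j\in\mathbb N$; * $(l_m)$ is a subsequence of a geometric sequence with positive first term and ratio $>1$, and there is $c>0$ with $\frac1c l_m\le \operatorname{diam}\Gamma_m\le c\,l_m$ (word metric for $A_m\cup B_m$); these conditions are required only for those $m$ with $k_m<\infty$; * $\Gamma_0$ is the direct product of $A_0$ and $B_0$; * for all $m$ the natural map $A_m\times B_m\to\Gamma_m/\Gamma'_m$ is an isomorphism, where $\Gamma'_m=\langle\langle[A_m,B_m]\rangle\rangle$ is the normal closure. (In particular this covers the case where $(\Gamma_m)$ is a sequence of expanders.) Let $\theta_m=(\theta^A_m,\theta^B_m):\Gamma_m\to A_m\times B_m$ be the resulting projection; every $\gamma\in\Gamma_m$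 is written uniquely as $\gamma=\gamma'\,\theta_m^A(\gamma)\,\theta_m^B(\gamma)$ with $\gamma'\in\Gamma_m'$. The diagonal product $\Delta$ is the group of pairs $(\boldsymbol g,t)$, $\boldsymbol g=(g_m)_m$ with $g_m:\mathbb Z\to\Gamma_m$, $t\in\mathbb Z$, with product $(\boldsymbol g,t)(\boldsymbol f,s)=((g_mf_m(\cdot-t))_m,t+s)$, generated by $$S_\Delta=\{(\mathrm{id},1)\}\cup\{((a_m\delta_0)_m,0):a\in A\}\cup\{((b_m\delta_{k_m})_m,0):b\in B\},$$ where the coordinates with $k_m=+\infty$ are trivial. Write $g'_m(x)=(g_m(x))'$. For $n\in\mathbb N$ let $F_n$ be the set of $\delta\in\Delta$ represented by a word $s_1\cdots s_r$ over $S_\Delta\cup S_\Delta^{-1}$ all of whose prefixes (including the empty one and the whole word) have their cursor in $\{0,\dots,n-1\}$. Let $\mathfrak l(n)$ be the integer with $k_{\mathfrak l(n)}\le n<k_{\mathfrak l(n)+1}$ and $\mathfrak L(n)=\mathfrak l(\kappa^n-1)$. Let $\Sigma_0=F_1$ and $\Sigma_{n+1}=\bigcup_{j=0}^{\kappa-1}\Sigma_{n+1}^j$,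 where $\Sigma^j_{n+1}$ is the set of $(\boldsymbol g,j\kappa^n)\in\Delta$ with * $\operatorname{supp}g_0\subseteq[0,j\kappa^n-1]\cup[(j+1)\kappa^n,\kappa^{n+1}-1]$; * $\operatorname{supp}g'_m\subseteq[k_m,j\kappa^n+k_m-1]\cup[(j+1)\kappa^n,\kappa^{n+1}-1]$ for $1\le m\le\mathfrak L(n)$; * $\operatorname{supp}g'_m\subseteq[k_m,\kappa^{n+1}-1]$ for $\mathfrak L(n)<m\le\mathfrak L(n+1)$; * $\operatorname{supp}g'_m=\emptyset$ for $m>\mathfrak L(n+1)$. Let $T_0=\Sigma_0$ and $T_{n+1}=\Sigma_{n+1}T_n$ be the tiles. **Proposition.** There is a constant $C_R>0$, depending only on the above data, such that $(\Sigma_n)$ is a right $(R_n,\varepsilon_n)$-Følner tiling shift of $\Delta$ with $$R_n=C_R\,\kappa^n\,l_{\mathfrak L(n)},\qquad \varepsilon_n=\frac2{\kappa^n}.$$ That is: $S_\Delta$ generates $\Delta$; the sets $\Sigma_n$ and $T_n$ are finite and the $T_n$ are non-empty; $T_{n+1}$ is the disjoint union of the sets $\sigma T_n$, $\sigma\in\Sigma_{n+1}$;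 $|T_ng\setminus T_n|/|T_n|\to0$ for every $g\in\Delta$; and for all $n$ $$\operatorname{diam}T_n\le R_n,\qquad |T_ns\setminus T_n|\le\varepsilon_n|T_n|\quad(s\in S_\Delta),$$ the diameter being taken for the left-invariant word metric $d(g,h)=|g^{-1}h|_{S_\Delta}$. Moreover, with the same constant, $\operatorname{diam}F_n\le C_R\,n\,l_{\mathfrak l(n-1)}$ for all $n\ge1$. -/

import Mathlib

open scoped Pointwise

section WordMetric

variable {G : Type*} [Group G]

/-- The words over `S`, letters of `S` and their inverses being allowed. -/
def IsWordOver (S : Set G) (w : List G) : Prop :=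
  ∀ s ∈ w, s ∈ S ∪ S⁻¹

/-- The word length of `g` with respect to `S` (`⊤` if `g` is not in the subgroup generated
by `S`). -/
noncomputable def wordLength (S : Set G) (g : G) : ℕ∞ :=
  sInf {n : ℕ∞ | ∃ w : List G, IsWordOver S w ∧ w.prod = g ∧ (w.length : ℕ∞) = n}

/-- The diameter of `T` for the left-invariant word metric `d(g,h) = |g⁻¹ h|_S`. -/
noncomputable def wordDiam (S T : Set G) : ℕ∞ :=
  ⨆ g ∈ T, ⨆ h ∈ T, wordLength S (g⁻¹ * h)

end WordMetric

section FolnerTilingShifts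

variable {G : Type*} [Group G]

/-- The tiles `T_0 = Σ_0`, `T_{n+1} = Σ_{n+1} T_n`. -/
def tile (Shift : ℕ → Set G) : ℕ → Set G
  | 0 => Shift 0
  | n + 1 => Shift (n + 1) * tile Shift n

/-- Right Følner tiling shifts: finite sets `Σ_n` whose tiles `T_n` form a right Følner sequence
(of nonempty finite sets), and such that `T_{n+1}` is the disjoint union of the translates
`σ T_n`, `σ ∈ Σ_{n+1}`. -/
structure IsRightFolnerTilingShift (Shift : ℕ → Set G) : Prop where
  finite : ∀ n, (Shift n).Finite
  tile_finite : ∀ n, (tile Shift n).Finite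
  tile_nonempty : ∀ n, (tile Shift n).Nonempty
  folner : ∀ g : G, Filter.Tendsto
    (fun n => (((tile Shift n * {g}) \ tile Shift n).ncard : ℝ) / ((tile Shift n).ncard : ℝ))
    Filter.atTop (nhds 0)
  tile_succ : ∀ n, tile Shift (n + 1) = ⋃ σ ∈ Shift (n + 1), σ • tile Shift n
  disjoint : ∀ n, (Shift (n + 1)).PairwiseDisjoint (fun σ => σ • tile Shift n)

/-- `(R_n, ε_n)`-Følner tiling shifts (right version), for a generating set `S` of `G`. -/
structure IsRightFolnerTilingShiftWith (S : Set G) (Shift : ℕ → Set G) (R ε : ℕ → ℝ) :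
    Prop where
  generating : Subgroup.closure S = ⊤
  isShift : IsRightFolnerTilingShift Shift
  diam_le : ∀ n, (wordDiam S (tile Shift n) : ENNReal) ≤ ENNReal.ofReal (R n)
  boundary_le : ∀ n, ∀ s ∈ S,
    (((tile Shift n * {s}) \ tile Shift n).ncard : ℝ) ≤ ε n * ((tile Shift n).ncard : ℝ)

end FolnerTilingShifts

/-- The natural map `A × B → Γ / ⟨⟨[A,B]⟩⟩`, `(a,b) ↦ [a b]`, for two homomorphisms
`A → Γ`, `B → Γ`. It is automatically a homomorphism. -/
def commutatorQuotientMap {A B Γ : Type*} [Group A] [Group B] [Group Γ]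
    (α : A →* Γ) (β : B →* Γ) (p : A × B) :
    Γ ⧸ Subgroup.normalClosure {c : Γ | ∃ a b, c = α a * β b * (α a)⁻¹ * (β b)⁻¹} :=
  QuotientGroup.mk (α p.1 * β p.2)

/-- The data defining a diagonal product: groups `Γ_m`, generated by copies
`A_m = α m (A)` and `B_m = β m (B)` of `A` and `B`, and two sequences `k` and `l`. The value
`k m = ⊤` means that the `m`-th factor is absent; conditions relating `Γ_m` to `l_m` are only
imposed on the factors which are present. -/
structure DiagonalProductData (A B : Type*) (Γ : ℕ → Type*) [Group A] [Group B]
    [∀ m, Group (Γ m)] where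
  κ : ℕ
  k : ℕ → ℕ∞
  l : ℕ → ℝ
  α : ∀ m, A →* Γ m
  β : ∀ m, B →* Γ m
  two_le_κ : 2 ≤ κ
  /-- `A_m` and `B_m` are copies of `A` and `B`. -/
  α_injective : ∀ m, Function.Injective (α m)
  β_injective : ∀ m, Function.Injective (β m)
  /-- `Γ_m` is generated by `A_m ∪ B_m`, that is, a quotient of `A * B`. -/
  generated : ∀ m, Subgroup.closure (Set.range (α m) ∪ Set.range (β m)) = ⊤
  /-- `k_0 = 0`, and `(k_m)_{m ≥ 1}` is a subsequence of `(κ ^ n)_n` as long as it is finite. -/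
  k_zero : k 0 = 0
  k_pow : ∀ m, 1 ≤ m → k m ≠ ⊤ → ∃ j : ℕ, k m = ((κ ^ j : ℕ) : ℕ∞)
  two_mul_k_le : ∀ m, 2 * k m ≤ k (m + 1)
  /-- `(l_m)` is a subsequence of a geometric sequence. -/
  l_geometric : ∃ l₀ q : ℝ, 0 < l₀ ∧ 1 < q ∧ ∃ e : ℕ → ℕ, StrictMono e ∧
    ∀ m, k m ≠ ⊤ → l m = l₀ * q ^ e m
  /-- `l_m / c ≤ diam Γ_m ≤ c l_m`. -/
  diam_bound : ∃ c : ℝ, 0 < c ∧ ∀ m, k m ≠ ⊤ →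
    ENNReal.ofReal (1 / c * l m) ≤
      (wordDiam (Set.range (α m) ∪ Set.range (β m)) Set.univ : ENNReal) ∧
    (wordDiam (Set.range (α m) ∪ Set.range (β m)) Set.univ : ENNReal) ≤ ENNReal.ofReal (c * l m)
  /-- `Γ_0` is the direct product of `A_0` and `B_0`. -/
  zero_commute : ∀ a b, Commute (α 0 a) (β 0 b)
  zero_bijective : Function.Bijective (fun p : A × B => α 0 p.1 * β 0 p.2)
  /-- The natural map `A_m × B_m → Γ_m / ⟨⟨[A_m,B_m]⟩⟩` is an isomorphism. -/
  quotient_bijective : ∀ m, Function.Bijective (commutatorQuotientMap (α m) (β m))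

namespace DiagonalProductData

variable {A B : Type*} {Γ : ℕ → Type*} [Group A] [Group B] [∀ m, Group (Γ m)]
  (D : DiagonalProductData A B Γ)

/-- The projection `θ_m = (θ_m^A, θ_m^B) : Γ_m → Γ_m / ⟨⟨[A_m,B_m]⟩⟩ ≃ A × B`. -/
noncomputable def θ (m : ℕ) (γ : Γ m) : A × B :=
  (Equiv.ofBijective _ (D.quotient_bijective m)).symm (QuotientGroup.mk γ)

/-- The element `γ' ∈ ⟨⟨[A_m,B_m]⟩⟩` such that `γ = γ' θ_m^A(γ) θ_m^B(γ)`. -/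
noncomputable def derived (m : ℕ) (γ : Γ m) : Γ m :=
  γ * (D.α m (D.θ m γ).1 * D.β m (D.θ m γ).2)⁻¹

/-- `k_m` as an integer; only used for finite `k_m`. -/
noncomputable def kz (m : ℕ) : ℤ := ((D.k m).toNat : ℤ)

/-- The generator moving the cursor. -/
def genT : (∀ m, Γ m) ≀ᵣ Multiplicative ℤ :=
  ⟨1, Multiplicative.ofAdd 1⟩

open Classical in
/-- The generator `((a_m δ_0)_m, 0)`. -/
noncomputable def genA (a : A) : (∀ m, Γ m) ≀ᵣ Multiplicative ℤ :=
  ⟨fun x m => if D.k m ≠ ⊤ ∧ x.toAdd = 0 then D.α m a else 1, 1⟩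

open Classical in
/-- The generator `((b_m δ_{k_m})_m, 0)`. -/
noncomputable def genB (b : B) : (∀ m, Γ m) ≀ᵣ Multiplicative ℤ :=
  ⟨fun x m => if D.k m ≠ ⊤ ∧ x.toAdd = D.kz m then D.β m b else 1, 1⟩

/-- The generating set `S_Δ`, in the ambient wreath product `(∏_m Γ_m) ≀ ℤ`. -/
def genSet : Set ((∀ m, Γ m) ≀ᵣ Multiplicative ℤ) :=
  {genT} ∪ Set.range D.genA ∪ Set.range D.genB

/-- The diagonal product `Δ`. The ambient wreath product is the one of all maps
`ℤ → ∏_m Γ_m`: for an element of `Δ` each coordinate `g_m : ℤ → Γ_m` has finite support. -/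
def Delta : Subgroup ((∀ m, Γ m) ≀ᵣ Multiplicative ℤ) :=
  Subgroup.closure D.genSet

/-- The generating set `S_Δ` as a subset of `Δ`. -/
def genDelta : Set D.Delta :=
  {δ | (δ : (∀ m, Γ m) ≀ᵣ Multiplicative ℤ) ∈ D.genSet}

variable {D} in
/-- The position `t` of the cursor of `(g, t) ∈ Δ`. -/
def cursor (δ : D.Delta) : ℤ := δ.1.right.toAdd

variable {D} in
/-- The lamp configuration `g_m : ℤ → Γ_m` of `(g, t) ∈ Δ`. -/
def lamp (δ : D.Delta) (m : ℕ) (x : ℤ) : Γ m := δ.1.left (Multiplicative.ofAdd x) m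

variable {D} in
/-- The map `g'_m` of `(g, t) ∈ Δ`. -/
noncomputable def lampDerived (δ : D.Delta) (m : ℕ) (x : ℤ) : Γ m := D.derived m (lamp δ m x)

variable {D} in
/-- The set of the positions of the cursor along a word. -/
def wordRange (w : List D.Delta) : Set ℤ :=
  {x | ∃ i ≤ w.length, x = cursor (w.take i).prod}

/-- `F_n`: the elements represented by a word whose range is contained in `{0, …, n-1}`. -/
def F (n : ℕ) : Set D.Delta :=
  {δ | ∃ w : List D.Delta, IsWordOver D.genDelta w ∧ w.prod = δ ∧
    wordRange w ⊆ Set.Ico 0 (n : ℤ)}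

/-- `𝔩(n)`: the integer such that `k_{𝔩(n)} ≤ n < k_{𝔩(n)+1}`. -/
noncomputable def level (n : ℕ) : ℕ := sSup {i : ℕ | D.k i ≤ (n : ℕ∞)}

/-- `𝔏(n) = 𝔩(κ ^ n - 1)`. -/
noncomputable def bigLevel (n : ℕ) : ℕ := D.level (D.κ ^ n - 1)

/-- The set `Σ^j_{n+1}`. One has `𝔏(n+1) ∈ {𝔏(n), 𝔏(n)+1}`: the third support condition is void
if `𝔏(n+1) = 𝔏(n)`, and concerns only `m = 𝔏(n)+1` otherwise. -/
def shiftPart (n j : ℕ) : Set D.Delta :=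
  {δ | cursor δ = j * (D.κ : ℤ) ^ n ∧
    Function.mulSupport (lamp δ 0) ⊆
      Set.Icc 0 (j * (D.κ : ℤ) ^ n - 1) ∪
        Set.Icc ((j + 1) * (D.κ : ℤ) ^ n) ((D.κ : ℤ) ^ (n + 1) - 1) ∧
    (∀ m, 1 ≤ m → m ≤ D.bigLevel n → Function.mulSupport (lampDerived δ m) ⊆
      Set.Icc (D.kz m) (j * (D.κ : ℤ) ^ n + D.kz m - 1) ∪
        Set.Icc ((j + 1) * (D.κ : ℤ) ^ n) ((D.κ : ℤ) ^ (n + 1) - 1)) ∧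
    (∀ m, D.bigLevel n < m → m ≤ D.bigLevel (n + 1) → Function.mulSupport (lampDerived δ m) ⊆
      Set.Icc (D.kz m) ((D.κ : ℤ) ^ (n + 1) - 1)) ∧
    (∀ m, D.bigLevel (n + 1) < m → Function.mulSupport (lampDerived δ m) = ∅)}

/-- The shifts: `Σ_0 = F_1 = F_{κ^0}` and `Σ_{n+1} = ⋃_{j < κ} Σ^j_{n+1}`. -/
def shift : ℕ → Set D.Delta
  | 0 => D.F 1
  | n + 1 => ⋃ j ∈ Finset.range D.κ, D.shiftPart n j

end DiagonalProductData

/-!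
The proof rests on an intrinsic description of the sets `F_N`. An element of the diagonal product
is determined by its cursor, its `0`-th lamps, which record the letters of `A` and `B`, and the
derived parts of its other lamps: this is the subgroup `coherent` of lamp configurations. Say that
a configuration is supported in `[0, N-1]` (`supportedIn`) if its `0`-th lamps are and if, for every
`m`, the `m`-th lamp at `x` lies in `A_m` for `x < k_m` and in `B_m` for `x ≥ N`. For coherent
configurations this means that the derived parts of the `m`-th lamps are supported in
`[k_m, N-1]`, and it is stable under products. The elements with such lamps and with cursor in
`[0, N-1]` form the set `box N`. Reading a word letter by letter gives `F_N ⊆ box N`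
(`F_subset_box`).

Conversely every coherent configuration supported in `[0, N-1]` has a word of length
`O(N l_{𝔩(N-1)})` (`exists_hasWordLE_config`). The derived parts are removed from the highest level
down to level `1`. At level `M` the interval is cut into blocks of length `k_M`, which are treated
one after the other (`exists_block`, `exists_blocks`). In a block, the required elements of `Γ'_M`
are alternating products of at most `diam Γ_M` letters of `A_M` and `B_M`, and the `i`-th letters
are written for all positions at once by a sweep of length `O(k_M)`. This does not disturb a level
`m > M`, since there the letters of `A` and of `B` are written at disjoint sets of positions, and
their products are trivial separately. The lower levels may be disturbed, but are treated later.
The cost of level `M` is `O(N diam Γ_M)`, hence `O(N l_M)`, and these bounds sum up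
geometrically.

For the tiling, the `j`-th part of the shift consists of the elements with cursor `j κ^n`, supported
in `[0, κ^(n+1) - 1]`, and trivial at the positions `[j κ^n + k_m, (j+1) κ^n - 1]` of the `m`-th
lamps (`mem_shiftPart_iff`). A product of such an element by an element of `box (κ^n)` displays the
lamps of the latter on `[k_m, κ^n - 1]`, which determine it (`eq_of_eqOn`); conversely, the lamps of
an element of `box (κ^(n+1))` in the block that contains its cursor extend to an element of
`box (κ^n)` (`exists_restrict`). So `T_n = box (κ^n)` by induction (`tile_eq_box`). Only the
generator `(id, 1)` can leave a box, and only from the slice where the cursor is maximal, which is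
the fraction `1/N` of `box N` (`ncard_boundary_le`).
-/

/-! ### Words of bounded length -/

section Words

variable {G : Type*} [Group G]

/-- `g` is represented by a word over `S` with at most `n` letters. -/
def HasWordLE (S : Set G) (n : ℕ) (g : G) : Prop :=
  ∃ w : List G, IsWordOver S w ∧ w.prod = g ∧ w.length ≤ n

variable {S : Set G} {m n : ℕ} {g h : G}

theorem IsWordOver.append {v w : List G} (hv : IsWordOver S v) (hw : IsWordOver S w) :
    IsWordOver S (v ++ w) := by
  intro s hs
  rcases List.mem_append.1 hs with h | h
  exacts [hv s h, hw s h]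

namespace HasWordLE

theorem one (n : ℕ) : HasWordLE S n 1 := ⟨[], by simp [IsWordOver], by simp, by simp⟩

theorem of_mem (h : g ∈ S) : HasWordLE S 1 g :=
  ⟨[g], by simp [IsWordOver, h], by simp, by simp⟩

theorem mul (hg : HasWordLE S m g) (hh : HasWordLE S n h) : HasWordLE S (m + n) (g * h) := by
  obtain ⟨v, hv, rfl, hvl⟩ := hg
  obtain ⟨w, hw, rfl, hwl⟩ := hh
  exact ⟨v ++ w, hv.append hw, by simp, by simp; omega⟩

theorem inv (hg : HasWordLE S m g) : HasWordLE S m g⁻¹ := by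
  obtain ⟨v, hv, rfl, hvl⟩ := hg
  refine ⟨(v.map (·⁻¹)).reverse, ?_, by rw [List.prod_inv_reverse], by simpa using hvl⟩
  intro s hs
  obtain ⟨t, ht, rfl⟩ : ∃ t ∈ v, t⁻¹ = s := by simpa using hs
  rcases hv t ht with h | h
  · exact Or.inr (by simpa using h)
  · exact Or.inl (by simpa using h)

theorem mono (hg : HasWordLE S m g) (h : m ≤ n) : HasWordLE S n g := by
  obtain ⟨v, hv, hp, hvl⟩ := hg
  exact ⟨v, hv, hp, hvl.trans h⟩

theorem pow (hg : HasWordLE S m g) (k : ℕ) : HasWordLE S (k * m) (g ^ k) := by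
  induction k with
  | zero => simpa using one _
  | succ k ih => rw [pow_succ, add_mul, one_mul]; exact ih.mul hg

theorem mem_closure (hg : HasWordLE S m g) : g ∈ Subgroup.closure S := by
  obtain ⟨v, hv, rfl, -⟩ := hg
  refine Subgroup.list_prod_mem _ fun s hs => ?_
  rcases hv s hs with h | h
  · exact Subgroup.subset_closure h
  · simpa using inv_mem (Subgroup.subset_closure (k := S) h)

theorem wordLength_le (hg : HasWordLE S m g) : wordLength S g ≤ m := by
  obtain ⟨v, hv, hp, hvl⟩ := hg
  have h : wordLength S g ≤ (v.length : ℕ∞) := sInf_le ⟨v, hv, hp, rfl⟩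
  exact h.trans (by exact_mod_cast hvl)

/-- A word in the ambient group lifts to the subgroup generated by `S`. -/
theorem subgroup_closure (hg : HasWordLE S m g) :
    HasWordLE {x : Subgroup.closure S | (x : G) ∈ S} m ⟨g, hg.mem_closure⟩ := by
  obtain ⟨v, hv, hp, hvl⟩ := hg
  have hc : ∀ s ∈ v, s ∈ Subgroup.closure S := fun s hs => by
    rcases hv s hs with h | h
    · exact Subgroup.subset_closure h
    · simpa using inv_mem (Subgroup.subset_closure (k := S) h)
  refine ⟨v.attach.map fun s => ⟨s.1, hc s.1 s.2⟩, ?_, ?_, by simpa using hvl⟩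
  · intro s hs
    obtain ⟨t, -, rfl⟩ := List.mem_map.1 hs
    simpa [Set.mem_inv] using hv t.1 t.2
  · apply Subtype.ext
    subst hp
    rw [← Subgroup.coe_subtype, map_list_prod]
    simp [List.map_map, Function.comp_def]

end HasWordLE

theorem hasWordLE_of_wordLength_le (h : wordLength S g ≤ n) : HasWordLE S n g := by
  have hne : {n : ℕ∞ | ∃ w : List G, IsWordOver S w ∧ w.prod = g ∧
      (w.length : ℕ∞) = n}.Nonempty := by
    by_contra hemp
    rw [Set.not_nonempty_iff_eq_empty] at hemp
    rw [wordLength, hemp, sInf_empty, top_le_iff] at h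
    exact ENat.natCast_ne_top n h
  obtain ⟨w, hw, hp, hl⟩ := csInf_mem hne
  refine ⟨w, hw, hp, ?_⟩
  have : (w.length : ℕ∞) ≤ n := hl.le.trans h
  exact_mod_cast this

theorem wordDiam_le {T : Set G} (h : ∀ g ∈ T, HasWordLE S n g) : wordDiam S T ≤ (2 * n : ℕ) := by
  refine iSup₂_le fun g hg => iSup₂_le fun k hk => ?_
  rw [two_mul]
  exact ((h g hg).inv.mul (h k hk)).wordLength_le

theorem hasWordLE_of_wordDiam_le (h : wordDiam S Set.univ ≤ n) (g : G) : HasWordLE S n g := by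
  refine hasWordLE_of_wordLength_le (le_trans ?_ h)
  have := le_iSup₂_of_le (f := fun g (_ : g ∈ (Set.univ : Set G)) =>
    ⨆ h ∈ (Set.univ : Set G), wordLength S (g⁻¹ * h)) 1 (Set.mem_univ _)
    (le_iSup₂_of_le (f := fun h (_ : h ∈ (Set.univ : Set G)) => wordLength S (1⁻¹ * h)) g
      (Set.mem_univ _) le_rfl)
  simpa [wordDiam] using this

theorem finite_setOf_hasWordLE (hS : S.Finite) (n : ℕ) : {g | HasWordLE S n g}.Finite := by
  have hfin : (S ∪ S⁻¹).Finite := hS.union hS.inv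
  have : Finite ↑(S ∪ S⁻¹) := hfin
  refine ((List.finite_length_le ↑(S ∪ S⁻¹) n).image fun l => (l.map Subtype.val).prod).subset ?_
  rintro g ⟨w, hw, rfl, hl⟩
  refine ⟨w.attach.map fun s => ⟨s.1, hw s.1 s.2⟩, by simpa using hl, ?_⟩
  simp [List.map_map, Function.comp_def]

/-- An element of a group generated by two subgroups is an alternating product. The number of
factors can be prescribed, since both `α 1` and `β 1` are trivial. -/
theorem exists_alternating_prod {A B : Type*} [Group A] [Group B] {α : A →* G} {β : B →* G}
    (h : HasWordLE (Set.range α ∪ Set.range β) n g) :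
    ∃ s : ℕ → A × B, ((List.range n).map fun i => α (s i).1 * β (s i).2).prod = g := by
  obtain ⟨w, hw, rfl, hl⟩ := h
  induction w generalizing n with
  | nil => exact ⟨fun _ => 1, by simp⟩
  | cons x w ih =>
    obtain ⟨n, rfl⟩ : ∃ k, n = k + 1 := ⟨n - 1, by simp at hl; omega⟩
    obtain ⟨s, hs⟩ := ih (n := n) (fun y hy => hw y (by simp [hy])) (by simpa using hl)
    obtain ⟨p, hp⟩ : ∃ p : A × B, α p.1 * β p.2 = x := by
      rcases hw x (by simp) with (⟨a, rfl⟩ | ⟨b, rfl⟩) | (⟨a, ha⟩ | ⟨b, hb⟩)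
      · exact ⟨(a, 1), by simp⟩
      · exact ⟨(1, b), by simp⟩
      · exact ⟨(a⁻¹, 1), by simp [ha]⟩
      · exact ⟨(1, b⁻¹), by simp [hb]⟩
    refine ⟨fun i => i.casesOn p s, ?_⟩
    rw [List.range_succ_eq_map]
    simp [List.map_map, Function.comp_def, hp, hs]

end Words

/-! ### The boundary of finite sets -/

section Boundary

variable {G : Type*} [Group G]

theorem ncard_mul_singleton (T : Set G) (g : G) : (T * {g}).ncard = T.ncard := by
  rw [Set.mul_singleton]
  exact Set.ncard_image_of_injective T (mul_left_injective g)

theorem ncard_boundary_mul_le {T : Set G} (hT : T.Finite) (g h : G) :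
    ((T * {g * h}) \ T).ncard ≤ ((T * {g}) \ T).ncard + ((T * {h}) \ T).ncard := by
  have hsub : (T * {g * h}) \ T ⊆ (((T * {g}) \ T) * {h}) ∪ ((T * {h}) \ T) := by
    intro x hx
    simp only [Set.mul_singleton, Set.mem_sdiff, Set.mem_image, Set.mem_union] at hx ⊢
    obtain ⟨⟨t, ht, rfl⟩, hx⟩ := hx
    by_cases htg : t * g ∈ T
    · exact Or.inr ⟨⟨t * g, htg, mul_assoc _ _ _⟩, hx⟩
    · exact Or.inl ⟨t * g, ⟨⟨t, ht, rfl⟩, htg⟩, mul_assoc _ _ _⟩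
  have hg : ((T * {g}) \ T).Finite := (hT.mul (Set.finite_singleton g)).sdiff
  have hh : ((T * {h}) \ T).Finite := (hT.mul (Set.finite_singleton h)).sdiff
  refine (Set.ncard_le_ncard hsub ((hg.mul (Set.finite_singleton h)).union hh)).trans ?_
  refine (Set.ncard_union_le _ _).trans ?_
  rw [ncard_mul_singleton]

theorem ncard_boundary_inv {T : Set G} (hT : T.Finite) (g : G) :
    ((T * {g⁻¹}) \ T).ncard = ((T * {g}) \ T).ncard := by
  have h1 : ((T * {g⁻¹}) \ T) * {g} = T \ (T * {g}) := by
    ext x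
    simp only [Set.mul_singleton, Set.mem_sdiff, Set.mem_image]
    constructor
    · rintro ⟨y, ⟨⟨t, ht, rfl⟩, hy⟩, rfl⟩
      refine ⟨by simpa using ht, ?_⟩
      rintro ⟨u, hu, hut⟩
      exact hy ((mul_right_cancel hut) ▸ hu)
    · rintro ⟨hx, hx'⟩
      refine ⟨x * g⁻¹, ⟨⟨x, hx, rfl⟩, fun h => hx' ⟨_, h, by simp⟩⟩, by simp⟩
  rw [← ncard_mul_singleton _ g, h1]
  have hTg := hT.mul (Set.finite_singleton g)
  have h2 := Set.ncard_sdiff_add_ncard T (T * {g}) hT hTg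
  have h3 := Set.ncard_sdiff_add_ncard (T * {g}) T hTg hT
  rw [Set.union_comm, ncard_mul_singleton] at h2
  omega

/-- The Følner condition only has to be checked on a generating set. -/
theorem folner_of_generators {S : Set G} (hS : Subgroup.closure S = ⊤) {T : ℕ → Set G}
    (hT : ∀ n, (T n).Finite)
    (h : ∀ s ∈ S, Filter.Tendsto (fun n => (((T n * {s}) \ T n).ncard : ℝ) / ((T n).ncard : ℝ))
      Filter.atTop (nhds 0)) (g : G) :
    Filter.Tendsto (fun n => (((T n * {g}) \ T n).ncard : ℝ) / ((T n).ncard : ℝ))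
      Filter.atTop (nhds 0) := by
  have hg : g ∈ Subgroup.closure S := hS ▸ Subgroup.mem_top g
  induction hg using Subgroup.closure_induction with
  | mem s hs => exact h s hs
  | one => simp
  | mul x y _ _ hx hy =>
    have hadd := hx.add hy
    rw [add_zero] at hadd
    refine squeeze_zero (fun n => by positivity) (fun n => ?_) hadd
    rw [← add_div]
    gcongr
    exact_mod_cast ncard_boundary_mul_le (hT n) x y
  | inv x _ hx =>
    simpa only [ncard_boundary_inv (hT _)] using hx

end Boundary

namespace DiagonalProductData

variable {A B : Type*} {Γ : ℕ → Type*} [Group A] [Group B] [∀ m, Group (Γ m)]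
  (D : DiagonalProductData A B Γ)

/-! ### The projections to `A × B` -/

theorem commutatorQuotientMap_mul {G : Type*} [Group G] (α : A →* G) (β : B →* G) (p q : A × B) :
    commutatorQuotientMap α β (p * q) =
      commutatorQuotientMap α β p * commutatorQuotientMap α β q := by
  simp only [commutatorQuotientMap, ← QuotientGroup.mk_mul]
  rw [QuotientGroup.eq]
  have h : α q.1 * β p.2 * (α q.1)⁻¹ * (β p.2)⁻¹ ∈
      Subgroup.normalClosure {c : G | ∃ a b, c = α a * β b * (α a)⁻¹ * (β b)⁻¹} :=
    Subgroup.subset_normalClosure ⟨_, _, rfl⟩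
  -- The two representatives differ by a conjugate of the inverse of `[α q.1, β p.2]`.
  have h2 := Subgroup.normalClosure_normal.conj_mem _ (inv_mem h) (β q.2⁻¹ * β p.2⁻¹ * α q.1⁻¹)
  convert h2 using 1
  simp only [Prod.fst_mul, Prod.snd_mul, map_mul, map_inv]
  group

/-- The projection `θ_m` as a homomorphism. -/
noncomputable def thetaHom (m : ℕ) : Γ m →* A × B where
  toFun := D.θ m
  map_one' := by
    rw [θ, Equiv.symm_apply_eq]
    simp [commutatorQuotientMap]
  map_mul' x y := by
    have h : ∀ z, commutatorQuotientMap (D.α m) (D.β m) (D.θ m z) = QuotientGroup.mk z :=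
      fun z => (Equiv.ofBijective _ (D.quotient_bijective m)).apply_symm_apply _
    apply (D.quotient_bijective m).1
    rw [commutatorQuotientMap_mul, h, h, h, QuotientGroup.mk_mul]

@[simp]
theorem thetaHom_mk (m : ℕ) (a : A) (b : B) : D.thetaHom m (D.α m a * D.β m b) = (a, b) := by
  change D.θ m _ = _
  rw [θ, Equiv.symm_apply_eq]
  rfl

@[simp]
theorem thetaHom_α (m : ℕ) (a : A) : D.thetaHom m (D.α m a) = (a, 1) := by
  simpa using D.thetaHom_mk m a 1

@[simp]
theorem thetaHom_β (m : ℕ) (b : B) : D.thetaHom m (D.β m b) = (1, b) := by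
  simpa using D.thetaHom_mk m 1 b

/-- The part `θ_m^A(γ) θ_m^B(γ)` of `γ`. -/
noncomputable def abelianPart (m : ℕ) (γ : Γ m) : Γ m :=
  D.α m (D.thetaHom m γ).1 * D.β m (D.thetaHom m γ).2

theorem derived_eq (m : ℕ) (γ : Γ m) : D.derived m γ = γ * (D.abelianPart m γ)⁻¹ := rfl

theorem derived_eq_one_iff {m : ℕ} {γ : Γ m} : D.derived m γ = 1 ↔ γ = D.abelianPart m γ := by
  rw [derived_eq, mul_inv_eq_one]

theorem thetaHom_abelianPart (m : ℕ) (γ : Γ m) :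
    D.thetaHom m (D.abelianPart m γ) = D.thetaHom m γ := by
  rw [abelianPart, thetaHom_mk]

theorem inv_derived_mul (m : ℕ) (γ : Γ m) : (D.derived m γ)⁻¹ * γ = D.abelianPart m γ := by
  rw [derived_eq, mul_inv_rev, inv_inv, inv_mul_cancel_right]

theorem derived_abelianPart (m : ℕ) (γ : Γ m) : D.derived m (D.abelianPart m γ) = 1 := by
  rw [derived_eq_one_iff]
  conv_rhs => rw [abelianPart, thetaHom_abelianPart]
  rfl

theorem thetaHom_derived (m : ℕ) (γ : Γ m) : D.thetaHom m (D.derived m γ) = 1 := by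
  rw [derived_eq, map_mul, map_inv, thetaHom_abelianPart, mul_inv_cancel]

theorem eq_of_mem_range_α {m : ℕ} {γ : Γ m} (h : γ ∈ (D.α m).range) :
    γ = D.α m (D.thetaHom m γ).1 ∧ (D.thetaHom m γ).2 = 1 := by
  obtain ⟨a, rfl⟩ := h
  simp

theorem eq_of_mem_range_β {m : ℕ} {γ : Γ m} (h : γ ∈ (D.β m).range) :
    γ = D.β m (D.thetaHom m γ).2 ∧ (D.thetaHom m γ).1 = 1 := by
  obtain ⟨b, rfl⟩ := h
  simp

theorem derived_of_mem_range_α {m : ℕ} {γ : Γ m} (h : γ ∈ (D.α m).range) :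
    D.derived m γ = 1 := by
  obtain ⟨a, rfl⟩ := h
  simp [derived_eq, abelianPart]

theorem derived_of_mem_range_β {m : ℕ} {γ : Γ m} (h : γ ∈ (D.β m).range) :
    D.derived m γ = 1 := by
  obtain ⟨b, rfl⟩ := h
  simp [derived_eq, abelianPart]

theorem derived_one (m : ℕ) : D.derived m 1 = 1 := D.derived_of_mem_range_α (one_mem _)

/-- In the direct product `Γ_0 = A_0 × B_0` every element is its own abelian part. -/
theorem eq_abelianPart_zero (γ : Γ 0) : γ = D.abelianPart 0 γ := by
  obtain ⟨⟨a, b⟩, rfl⟩ := D.zero_bijective.2 γ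
  simp [abelianPart]

theorem eq_one_of_thetaHom_zero {γ : Γ 0} (h : D.thetaHom 0 γ = 1) : γ = 1 := by
  rw [D.eq_abelianPart_zero γ, abelianPart, h]
  simp

/-! ### The sequence `k` and the levels -/

theorem k_monotone : Monotone D.k :=
  monotone_nat_of_le_succ fun m =>
    le_trans (by rw [two_mul]; exact le_self_add) (D.two_mul_k_le m)

theorem k_ne_top_of_le {m n : ℕ} (h : m ≤ n) (hn : D.k n ≠ ⊤) : D.k m ≠ ⊤ :=
  ne_top_of_le_ne_top hn (D.k_monotone h)

theorem coe_toNat_k {m : ℕ} (h : D.k m ≠ ⊤) : ((D.k m).toNat : ℕ∞) = D.k m := ENat.natCast_toNat h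

theorem kz_nonneg (m : ℕ) : 0 ≤ D.kz m := Int.natCast_nonneg _

@[simp]
theorem kz_zero : D.kz 0 = 0 := by simp [kz, D.k_zero]

theorem k_zero_ne_top : D.k 0 ≠ ⊤ := by simp [D.k_zero]

theorem one_le_k {m : ℕ} (hm : 1 ≤ m) : 1 ≤ D.k m := by
  by_cases h : D.k m = ⊤
  · simp [h]
  · obtain ⟨j, hj⟩ := D.k_pow m hm h
    rw [hj]
    have : 1 ≤ D.κ ^ j := Nat.one_le_pow _ _ (by linarith [D.two_le_κ])
    exact_mod_cast this

theorem k_le_natCast_iff {m : ℕ} (h : D.k m ≠ ⊤) (n : ℕ) : D.k m ≤ n ↔ D.kz m ≤ n := by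
  rw [kz, ← D.coe_toNat_k h]
  simp

theorem two_mul_kz_le {m n : ℕ} (h : m < n) (hn : D.k n ≠ ⊤) : 2 * D.kz m ≤ D.kz n := by
  have h1 : 2 * D.k m ≤ D.k n := (D.two_mul_k_le m).trans (D.k_monotone h)
  rw [← D.coe_toNat_k hn, ← D.coe_toNat_k (D.k_ne_top_of_le h.le hn)] at h1
  have h2 : 2 * (D.k m).toNat ≤ (D.k n).toNat := by exact_mod_cast h1
  simp only [kz]
  exact_mod_cast h2

theorem natCast_le_k (m : ℕ) : (m : ℕ∞) ≤ D.k m := by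
  induction m with
  | zero => simp
  | succ m ih =>
    rcases Nat.eq_zero_or_pos m with rfl | hm
    · simpa using D.one_le_k le_rfl
    · refine le_trans ?_ (D.two_mul_k_le m)
      rw [two_mul]
      push_cast
      exact add_le_add ih (D.one_le_k hm)

theorem le_level_iff (m n : ℕ) : m ≤ D.level n ↔ D.k m ≤ n := by
  have hb : BddAbove {i : ℕ | D.k i ≤ (n : ℕ∞)} :=
    ⟨n, fun i hi => by exact_mod_cast (D.natCast_le_k i).trans hi⟩
  refine ⟨fun h => (D.k_monotone h).trans ?_, fun h => le_csSup hb h⟩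
  exact Nat.sSup_mem (s := {i : ℕ | D.k i ≤ (n : ℕ∞)}) ⟨0, by simp [D.k_zero]⟩ hb

theorem k_level_ne_top (n : ℕ) : D.k (D.level n) ≠ ⊤ :=
  ne_top_of_le_ne_top (ENat.natCast_ne_top n) ((D.le_level_iff _ n).1 le_rfl)

theorem le_level_pred_iff {m N : ℕ} (hN : 1 ≤ N) (hm : D.k m ≠ ⊤) :
    m ≤ D.level (N - 1) ↔ D.kz m < N := by
  rw [le_level_iff, D.k_le_natCast_iff hm]
  omega

theorem κ_pow_pos (n : ℕ) : 1 ≤ D.κ ^ n := Nat.one_le_pow _ _ (by linarith [D.two_le_κ])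

/-! ### Lamp configurations -/

/-- Shifting all lamps by `u`. -/
def translate (u : ℤ) : (∀ m, ℤ → Γ m) →* (∀ m, ℤ → Γ m) where
  toFun f := fun m x => f m (x - u)
  map_one' := rfl
  map_mul' _ _ := rfl

@[simp]
theorem translate_apply (u : ℤ) (f : ∀ m, ℤ → Γ m) (m : ℕ) (x : ℤ) :
    translate u f m x = f m (x - u) := rfl

@[simp]
theorem translate_zero (f : ∀ m, ℤ → Γ m) : translate 0 f = f := by
  funext m x
  simp

/-- The element of the wreath product with lamps `f` and cursor `t`. -/
def config (f : ∀ m, ℤ → Γ m) (t : ℤ) : (∀ m, Γ m) ≀ᵣ Multiplicative ℤ :=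
  ⟨fun x m => f m x.toAdd, Multiplicative.ofAdd t⟩

/-- The lamps of an element of the wreath product. -/
def lamps (w : (∀ m, Γ m) ≀ᵣ Multiplicative ℤ) : ∀ m, ℤ → Γ m :=
  fun m x => w.left (Multiplicative.ofAdd x) m

theorem config_mul (f g : ∀ m, ℤ → Γ m) (t s : ℤ) :
    config f t * config g s = config (f * translate t g) (t + s) := by
  refine RegularWreathProduct.ext ?_ rfl
  funext x m
  change f m x.toAdd * g m (-t + x.toAdd) = f m x.toAdd * g m (x.toAdd - t)
  rw [neg_add_eq_sub]

theorem config_one_zero : config (1 : ∀ m, ℤ → Γ m) 0 = 1 := rfl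

omit [∀ m, Group (Γ m)] in
theorem config_lamps (w : (∀ m, Γ m) ≀ᵣ Multiplicative ℤ) :
    config (lamps w) w.right.toAdd = w := rfl

omit [∀ m, Group (Γ m)] in
theorem lamps_config (f : ∀ m, ℤ → Γ m) (t : ℤ) : lamps (config f t) = f := rfl

theorem lamps_mul (v w : (∀ m, Γ m) ≀ᵣ Multiplicative ℤ) :
    lamps (v * w) = lamps v * translate v.right.toAdd (lamps w) := by
  conv_lhs => rw [← config_lamps v, ← config_lamps w, config_mul, lamps_config]

theorem lamps_inv (v : (∀ m, Γ m) ≀ᵣ Multiplicative ℤ) :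
    lamps v⁻¹ = (translate (-v.right.toAdd) (lamps v))⁻¹ := by
  funext m x
  change (v.left (v.right * Multiplicative.ofAdd x) m)⁻¹ =
    (v.left (Multiplicative.ofAdd (x - -v.right.toAdd)) m)⁻¹
  rw [sub_neg_eq_add, add_comm]
  rfl

theorem config_inv (f : ∀ m, ℤ → Γ m) (t : ℤ) :
    (config f t)⁻¹ = config (translate (-t) f)⁻¹ (-t) := by
  rw [← config_lamps (config f t)⁻¹, lamps_inv]
  rfl

open Classical in
/-- The lamp configuration obtained by writing `f x` in all the lamps at `x`. -/
noncomputable def lampA : (ℤ → A) →* (∀ m, ℤ → Γ m) where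
  toFun f := fun m x => if D.k m = ⊤ then 1 else D.α m (f x)
  map_one' := by funext m x; simp
  map_mul' f g := by funext m x; by_cases h : D.k m = ⊤ <;> simp [h]

open Classical in
/-- The lamp configuration obtained by writing `f x` in the `m`-th lamp at `x + k_m`,
for all `m`. -/
noncomputable def lampB : (ℤ → B) →* (∀ m, ℤ → Γ m) where
  toFun f := fun m x => if D.k m = ⊤ then 1 else D.β m (f (x - D.kz m))
  map_one' := by funext m x; simp
  map_mul' f g := by funext m x; by_cases h : D.k m = ⊤ <;> simp [h]

theorem lampA_apply {m : ℕ} (h : D.k m ≠ ⊤) (f : ℤ → A) (x : ℤ) :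
    D.lampA f m x = D.α m (f x) := if_neg h

theorem lampB_apply {m : ℕ} (h : D.k m ≠ ⊤) (f : ℤ → B) (x : ℤ) :
    D.lampB f m x = D.β m (f (x - D.kz m)) := if_neg h

theorem lampA_apply_top {m : ℕ} (h : D.k m = ⊤) (f : ℤ → A) (x : ℤ) :
    D.lampA f m x = 1 := if_pos h

theorem lampB_apply_top {m : ℕ} (h : D.k m = ⊤) (f : ℤ → B) (x : ℤ) :
    D.lampB f m x = 1 := if_pos h

theorem genT_eq : (genT : (∀ m, Γ m) ≀ᵣ Multiplicative ℤ) = config 1 1 := rfl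

theorem genA_eq (a : A) : D.genA a = config (D.lampA (Pi.mulSingle 0 a)) 0 := by
  refine RegularWreathProduct.ext ?_ rfl
  funext x m
  simp only [genA, config]
  by_cases h : D.k m = ⊤
  · simp [h, lampA_apply_top]
  · by_cases hx : x.toAdd = 0 <;> simp [h, hx, lampA_apply]

theorem genB_eq (b : B) : D.genB b = config (D.lampB (Pi.mulSingle 0 b)) 0 := by
  refine RegularWreathProduct.ext ?_ rfl
  funext x m
  simp only [genB, config]
  by_cases h : D.k m = ⊤
  · simp [h, lampB_apply_top]
  · by_cases hx : x.toAdd = D.kz m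
    · simp [h, hx, lampB_apply]
    · simp [h, hx, lampB_apply, sub_eq_zero]

/-- The lamp configurations in which all the abelian parts are determined by the `0`-th lamps, as
is the case for the elements of the diagonal product. -/
def coherent : Subgroup (∀ m, ℤ → Γ m) where
  carrier := {f | (∀ m, D.k m = ⊤ → ∀ x, f m x = 1) ∧ ∀ m, D.k m ≠ ⊤ → ∀ x,
    (D.thetaHom m (f m x)).1 = (D.thetaHom 0 (f 0 x)).1 ∧
    (D.thetaHom m (f m x)).2 = (D.thetaHom 0 (f 0 (x - D.kz m))).2}
  one_mem' := by simp
  mul_mem' {f g} hf hg := by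
    refine ⟨fun m hm x => by simp [hf.1 m hm, hg.1 m hm], fun m hm x => ?_⟩
    simp [hf.2 m hm, hg.2 m hm]
  inv_mem' {f} hf := by
    refine ⟨fun m hm x => by simp [hf.1 m hm], fun m hm x => ?_⟩
    simp [hf.2 m hm]

theorem translate_mem_coherent {f : ∀ m, ℤ → Γ m} (hf : f ∈ D.coherent) (u : ℤ) :
    translate u f ∈ D.coherent := by
  refine ⟨fun m hm x => hf.1 m hm _, fun m hm x => ?_⟩
  have := hf.2 m hm (x - u)
  simpa [sub_right_comm] using this

theorem lampA_mem_coherent (f : ℤ → A) : D.lampA f ∈ D.coherent :=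
  ⟨fun _ hm x => D.lampA_apply_top hm f x, fun m hm x => by
    simp [lampA_apply, hm, D.k_zero_ne_top]⟩

theorem lampB_mem_coherent (f : ℤ → B) : D.lampB f ∈ D.coherent :=
  ⟨fun _ hm x => D.lampB_apply_top hm f x, fun m hm x => by
    simp [lampB_apply, hm, D.k_zero_ne_top]⟩

theorem lamps_mem_coherent {w : (∀ m, Γ m) ≀ᵣ Multiplicative ℤ} (hw : w ∈ D.Delta) :
    lamps w ∈ D.coherent := by
  induction hw using Subgroup.closure_induction with
  | mem w hw =>
    rcases hw with (rfl | ⟨a, rfl⟩) | ⟨b, rfl⟩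
    · exact one_mem _
    · rw [genA_eq]; exact D.lampA_mem_coherent _
    · rw [genB_eq]; exact D.lampB_mem_coherent _
  | one => exact one_mem _
  | mul v w _ _ hv hw => rw [lamps_mul]; exact mul_mem hv (D.translate_mem_coherent hw _)
  | inv v _ hv => rw [lamps_inv]; exact inv_mem (D.translate_mem_coherent hv _)

/-- The lamp configurations which can be produced with a cursor staying in `[0, N-1]`. For a
coherent configuration `f`, this says that `f_0` is supported in `[0, N-1]` and `f'_m` in
`[k_m, N-1]`; in the form used here the condition is visibly stable under products. -/
def supportedIn (N : ℤ) : Subgroup (∀ m, ℤ → Γ m) where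
  carrier := {f | (∀ x, x < 0 ∨ N ≤ x → f 0 x = 1) ∧ ∀ m, D.k m ≠ ⊤ → ∀ x,
    (x < D.kz m → f m x ∈ (D.α m).range) ∧ (N ≤ x → f m x ∈ (D.β m).range)}
  one_mem' := ⟨fun _ _ => rfl, fun _ _ _ => ⟨fun _ => one_mem _, fun _ => one_mem _⟩⟩
  mul_mem' {f g} hf hg := ⟨fun x hx => by simp [hf.1 x hx, hg.1 x hx], fun m hm x =>
    ⟨fun h => mul_mem ((hf.2 m hm x).1 h) ((hg.2 m hm x).1 h),
      fun h => mul_mem ((hf.2 m hm x).2 h) ((hg.2 m hm x).2 h)⟩⟩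
  inv_mem' {f} hf := ⟨fun x hx => by simp [hf.1 x hx], fun m hm x =>
    ⟨fun h => inv_mem ((hf.2 m hm x).1 h), fun h => inv_mem ((hf.2 m hm x).2 h)⟩⟩

theorem translate_mem_supportedIn {N N' u : ℤ} {f : ∀ m, ℤ → Γ m} (hf : f ∈ D.supportedIn N)
    (hu : 0 ≤ u) (h : N + u ≤ N') : translate u f ∈ D.supportedIn N' :=
  ⟨fun x hx => hf.1 _ (by omega), fun m hm x =>
    ⟨fun hx => (hf.2 m hm _).1 (by omega), fun hx => (hf.2 m hm _).2 (by omega)⟩⟩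

theorem lampA_mem_supportedIn {N : ℤ} {f : ℤ → A} (hf : ∀ x, f x ≠ 1 → 0 ≤ x ∧ x < N) :
    D.lampA f ∈ D.supportedIn N := by
  have h1 : ∀ x, x < 0 ∨ N ≤ x → f x = 1 := fun x hx => by
    by_contra h
    have := hf x h
    omega
  refine ⟨fun x hx => by simp [lampA_apply, D.k_zero_ne_top, h1 x hx], fun m hm x => ?_⟩
  rw [D.lampA_apply hm]
  exact ⟨fun _ => ⟨_, rfl⟩, fun hx => by simp [h1 x (Or.inr hx), one_mem]⟩

theorem lampB_mem_supportedIn {N : ℤ} {f : ℤ → B} (hf : ∀ x, f x ≠ 1 → 0 ≤ x ∧ x < N) :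
    D.lampB f ∈ D.supportedIn N := by
  have h1 : ∀ x, x < 0 ∨ N ≤ x → f x = 1 := fun x hx => by
    by_contra h
    have := hf x h
    omega
  refine ⟨fun x hx => by simp [lampB_apply, D.k_zero_ne_top, h1 x hx], fun m hm x => ?_⟩
  rw [D.lampB_apply hm]
  exact ⟨fun hx => by simp [h1 (x - D.kz m) (by omega), one_mem], fun _ => ⟨_, rfl⟩⟩

/-! ### Words for lamp configurations -/

variable {D} in
/-- Concatenation of words, in terms of lamps and cursor. -/
theorem hasWordLE_config_mul {m n : ℕ} {f g : ∀ m, ℤ → Γ m} {t s : ℤ}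
    (hf : HasWordLE D.genSet m (config f t)) (hg : HasWordLE D.genSet n (config g s)) :
    HasWordLE D.genSet (m + n) (config (f * translate t g) (t + s)) := by
  rw [← config_mul]
  exact hf.mul hg

theorem config_one_natCast (n : ℕ) :
    config (1 : ∀ m, ℤ → Γ m) n = (genT : (∀ m, Γ m) ≀ᵣ Multiplicative ℤ) ^ n := by
  induction n with
  | zero => rfl
  | succ n ih => rw [pow_succ, ← ih, genT_eq, config_mul, map_one, mul_one]; rfl

theorem genT_mem : genT ∈ D.genSet := Or.inl (Or.inl rfl)

theorem genA_mem (a : A) : D.genA a ∈ D.genSet := Or.inl (Or.inr ⟨a, rfl⟩)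

theorem genB_mem (b : B) : D.genB b ∈ D.genSet := Or.inr ⟨b, rfl⟩

theorem hasWordLE_cursor (n : ℕ) :
    HasWordLE D.genSet n (config (1 : ∀ m, ℤ → Γ m) n) := by
  rw [config_one_natCast]
  simpa using (HasWordLE.of_mem D.genT_mem).pow n

theorem hasWordLE_cursor_neg (n : ℕ) :
    HasWordLE D.genSet n (config (1 : ∀ m, ℤ → Γ m) (-n)) := by
  simpa [config_inv] using (D.hasWordLE_cursor n).inv

variable {D} in
/-- Bringing the cursor back to `0`. -/
theorem HasWordLE.cursor_return {m n : ℕ} {f : ∀ m, ℤ → Γ m}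
    (hf : HasWordLE D.genSet m (config f n)) : HasWordLE D.genSet (m + n) (config f 0) := by
  simpa using hasWordLE_config_mul hf (D.hasWordLE_cursor_neg n)

theorem translate_lampA (u : ℤ) (f : ℤ → A) :
    translate u (D.lampA f) = D.lampA fun x => f (x - u) := by
  funext m x
  by_cases h : D.k m = ⊤ <;> simp [lampA_apply_top, lampA_apply, h]

theorem translate_lampB (u : ℤ) (f : ℤ → B) :
    translate u (D.lampB f) = D.lampB fun x => f (x - u) := by
  funext m x
  by_cases h : D.k m = ⊤ <;> simp [lampB_apply_top, lampB_apply, h, sub_right_comm]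

/-- A function supported in `[0, n+1)` as a product of functions supported in `[0, n)`
and `{n}`. -/
theorem exists_eq_mul_mulSingle {M : Type*} [Group M] {n : ℕ} {f : ℤ → M}
    (hf : ∀ x, f x ≠ 1 → 0 ≤ x ∧ x < (n + 1 : ℕ)) :
    ∃ g : ℤ → M, (∀ x, g x ≠ 1 → 0 ≤ x ∧ x < n) ∧
      f = g * fun x => (Pi.mulSingle 0 (f n) : ℤ → M) (x - n) := by
  refine ⟨Function.update f n 1, fun x hx => ?_, funext fun x => ?_⟩
  · by_cases h : x = n
    · simp [h] at hx
    · rw [Function.update_of_ne h] at hx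
      have := hf x hx
      push_cast at this
      omega
  · by_cases h : x = n
    · simp [h]
    · simp [h, sub_eq_zero]

/-- One sweep of the cursor writes any element of `A` at every position of an interval. -/
theorem hasWordLE_lampA_sweep (n : ℕ) (f : ℤ → A) (hf : ∀ x, f x ≠ 1 → 0 ≤ x ∧ x < n) :
    HasWordLE D.genSet (2 * n) (config (D.lampA f) n) := by
  induction n generalizing f with
  | zero =>
    have : f = 1 := funext fun x => by
      by_contra h
      have := hf x h
      push_cast at this
      omega
    rw [this, map_one]
    exact HasWordLE.one _
  | succ n ih =>
    obtain ⟨g, hg, hfg⟩ := exists_eq_mul_mulSingle hf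
    have h1 := hasWordLE_config_mul (ih g hg)
      (D.genA_eq (f n) ▸ HasWordLE.of_mem (D.genA_mem (f n)))
    have h2 := hasWordLE_config_mul h1 (genT_eq (Γ := Γ) ▸ HasWordLE.of_mem D.genT_mem)
    rw [map_one, mul_one, translate_lampA, ← map_mul, ← hfg] at h2
    rw [Nat.cast_succ]
    exact h2.mono (by omega)

theorem hasWordLE_lampB_sweep (n : ℕ) (f : ℤ → B) (hf : ∀ x, f x ≠ 1 → 0 ≤ x ∧ x < n) :
    HasWordLE D.genSet (2 * n) (config (D.lampB f) n) := by
  induction n generalizing f with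
  | zero =>
    have : f = 1 := funext fun x => by
      by_contra h
      have := hf x h
      push_cast at this
      omega
    rw [this, map_one]
    exact HasWordLE.one _
  | succ n ih =>
    obtain ⟨g, hg, hfg⟩ := exists_eq_mul_mulSingle hf
    have h1 := hasWordLE_config_mul (ih g hg)
      (D.genB_eq (f n) ▸ HasWordLE.of_mem (D.genB_mem (f n)))
    have h2 := hasWordLE_config_mul h1 (genT_eq (Γ := Γ) ▸ HasWordLE.of_mem D.genT_mem)
    rw [map_one, mul_one, translate_lampB, ← map_mul, ← hfg] at h2
    rw [Nat.cast_succ]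
    exact h2.mono (by omega)

theorem hasWordLE_lampA_mul_lampB {n : ℕ} {f : ℤ → A} {g : ℤ → B}
    (hf : ∀ x, f x ≠ 1 → 0 ≤ x ∧ x < n) (hg : ∀ x, g x ≠ 1 → 0 ≤ x ∧ x < n) :
    HasWordLE D.genSet (6 * n) (config (D.lampA f * D.lampB g) 0) := by
  have := hasWordLE_config_mul (HasWordLE.cursor_return (D.hasWordLE_lampA_sweep n f hf))
    (HasWordLE.cursor_return (D.hasWordLE_lampB_sweep n g hg))
  rw [translate_zero, add_zero] at this
  exact this.mono (by omega)

theorem hasWordLE_config_prod {ℓ : ℕ} {F : ℕ → ∀ m, ℤ → Γ m}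
    (hF : ∀ i, HasWordLE D.genSet ℓ (config (F i) 0)) (r : ℕ) :
    HasWordLE D.genSet (r * ℓ) (config ((List.range r).map F).prod 0) := by
  induction r with
  | zero => exact HasWordLE.one _
  | succ r ih =>
    have := hasWordLE_config_mul ih (hF r)
    rw [List.range_succ, add_mul, one_mul]
    simpa [List.prod_append] using this

theorem list_prod_lamps_apply (F : ℕ → ∀ m, ℤ → Γ m) (r m : ℕ) (x : ℤ) :
    ((List.range r).map F).prod m x = ((List.range r).map fun i => F i m x).prod := by
  induction r with
  | zero => rfl
  | succ r ih => simp [List.range_succ, ih]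

/-! ### Words for the derived parts -/

/-- Writing elements of `Γ'_M` in the `M`-th lamps at the positions of a block of length `k_M`.
The `i`-th letters of the alternating words for these elements are written simultaneously for all
positions of the block, by one sweep over the letters in `A` and another one over the letters in
`B`. At a level `m > M` the letters in `A` and those in `B` land in disjoint sets of positions
because `k_m - k_M ≥ k_M`, hence cancel separately; at level `0` they cancel separately because
`A_0` and `B_0` commute. Levels `0 < m < M` are not controlled. -/
theorem exists_block {M : ℕ} (hk : D.k M ≠ ⊤) {r : ℕ}
    (hr : ∀ γ : Γ M, HasWordLE (Set.range (D.α M) ∪ Set.range (D.β M)) r γ) {y N : ℤ}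
    (hy : 0 ≤ y) {c : ℤ → Γ M} (hθ : ∀ x, D.thetaHom M (c x) = 1)
    (hc : ∀ x, c x ≠ 1 → y + D.kz M ≤ x ∧ x < y + 2 * D.kz M ∧ x < N) :
    ∃ h : ∀ m, ℤ → Γ m, h M = c ∧ (∀ m x, m = 0 ∨ M < m → h m x = 1) ∧ h ∈ D.supportedIn N ∧
      HasWordLE D.genSet (r * (12 * (D.k M).toNat)) (config (translate (-y) h) 0) := by
  have hs : ∀ x, ∃ s : ℕ → A × B, (c x = 1 → ∀ i, s i = 1) ∧
      ((List.range r).map fun i => D.α M (s i).1 * D.β M (s i).2).prod = c x := fun x => by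
    by_cases h : c x = 1
    · exact ⟨fun _ => 1, fun _ _ => rfl, by simp [h]⟩
    · obtain ⟨s, hs⟩ := exists_alternating_prod (hr (c x))
      exact ⟨s, fun h' => absurd h' h, hs⟩
  choose s hs1 hs using hs
  have hprod : ∀ x, ((List.range r).map fun i => s x i).prod = 1 := fun x => by
    have := hθ x
    rw [← hs x, map_list_prod, List.map_map] at this
    simpa [Function.comp_def] using this
  have hprodA : ∀ x, ((List.range r).map fun i => (s x i).1).prod = 1 := fun x => by
    simpa [map_list_prod, Function.comp_def] using congrArg (MonoidHom.fst A B) (hprod x)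
  have hprodB : ∀ x, ((List.range r).map fun i => (s x i).2).prod = 1 := fun x => by
    simpa [map_list_prod, Function.comp_def] using congrArg (MonoidHom.snd A B) (hprod x)
  have hne : ∀ x i, s x i ≠ 1 → y + D.kz M ≤ x ∧ x < y + 2 * D.kz M ∧ x < N :=
    fun x i h => hc x fun h' => h (hs1 x h' i)
  have hA1 : ∀ x i, (s x i).1 ≠ 1 → y + D.kz M ≤ x ∧ x < y + 2 * D.kz M ∧ x < N :=
    fun x i h => hne x i fun h' => h (by rw [h']; rfl)
  have hB1 : ∀ x i, (s x i).2 ≠ 1 → y + D.kz M ≤ x ∧ x < y + 2 * D.kz M ∧ x < N :=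
    fun x i h => hne x i fun h' => h (by rw [h']; rfl)
  set F : ℕ → ∀ m, ℤ → Γ m := fun i =>
    D.lampA (fun x => (s x i).1) * D.lampB (fun x => (s (x + D.kz M) i).2) with hF
  have hFapp : ∀ m, D.k m ≠ ⊤ → ∀ x i,
      F i m x = D.α m (s x i).1 * D.β m (s (x - D.kz m + D.kz M) i).2 := fun m hm x i => by
    simp [hF, lampA_apply, lampB_apply, hm]
  have hk0 := D.kz_nonneg M
  refine ⟨((List.range r).map F).prod, ?_, ?_, ?_, ?_⟩
  · funext x
    rw [list_prod_lamps_apply, ← hs x]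
    simp [hFapp M hk]
  · rintro m x (rfl | hm)
    · refine D.eq_one_of_thetaHom_zero ?_
      rw [list_prod_lamps_apply, map_list_prod, List.map_map]
      have h2 : (D.thetaHom 0 ∘ fun i => F i 0 x) =
          fun i => ((s x i).1, (s (x - D.kz 0 + D.kz M) i).2) := by
        funext i
        simp only [Function.comp_apply, hFapp 0 D.k_zero_ne_top, thetaHom_mk]
      rw [h2]
      refine Prod.ext ?_ ?_
      · rw [← MonoidHom.coe_fst, map_list_prod, List.map_map]
        exact hprodA x
      · rw [← MonoidHom.coe_snd, map_list_prod, List.map_map]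
        exact hprodB _
    · rw [list_prod_lamps_apply]
      by_cases hmt : D.k m = ⊤
      · simp [hF, lampA_apply_top, lampB_apply_top, hmt]
      simp only [hFapp m hmt]
      by_cases hcx : c x = 1
      · have h2 := congrArg (D.β m) (hprodB (x - D.kz m + D.kz M))
        rw [map_list_prod, List.map_map, map_one] at h2
        simpa [hs1 x hcx, Function.comp_def] using h2
      · have h3 := hc x hcx
        have h4 := D.two_mul_kz_le hm hmt
        have h5 : ∀ i, (s (x - D.kz m + D.kz M) i).2 = 1 := fun i => by
          by_contra h
          have := hB1 _ i h
          omega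
        have h2 := congrArg (D.α m) (hprodA x)
        rw [map_list_prod, List.map_map, map_one] at h2
        simpa [h5, Function.comp_def] using h2
  · refine Subgroup.list_prod_mem _ fun g hg => ?_
    obtain ⟨i, -, rfl⟩ := List.mem_map.1 hg
    refine mul_mem (D.lampA_mem_supportedIn fun x hx => ?_)
      (D.lampB_mem_supportedIn fun x hx => ?_)
    · have := hA1 x i hx
      omega
    · have := hB1 _ i hx
      omega
  · rw [map_list_prod, List.map_map]
    refine D.hasWordLE_config_prod (fun i => ?_) r
    simp only [Function.comp_apply, hF, map_mul, translate_lampA, translate_lampB]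
    have h2 : (((2 * (D.k M).toNat : ℕ)) : ℤ) = 2 * D.kz M := by simp [kz]
    refine (D.hasWordLE_lampA_mul_lampB (n := 2 * (D.k M).toNat) ?_ ?_).mono (by omega)
    · intro x hx
      have := hA1 _ i hx
      omega
    · intro x hx
      have := hB1 _ i hx
      omega

/-- Treating `J` consecutive blocks one after the other. -/
theorem exists_blocks {M : ℕ} (hk : D.k M ≠ ⊤) {r : ℕ}
    (hr : ∀ γ : Γ M, HasWordLE (Set.range (D.α M) ∪ Set.range (D.β M)) r γ) {N : ℤ}
    (J : ℕ) {c : ℤ → Γ M} (hθ : ∀ x, D.thetaHom M (c x) = 1)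
    (hc : ∀ x, c x ≠ 1 → D.kz M ≤ x ∧ x < D.kz M + (J * (D.k M).toNat : ℕ) ∧ x < N) :
    ∃ h : ∀ m, ℤ → Γ m, h M = c ∧ (∀ m x, m = 0 ∨ M < m → h m x = 1) ∧ h ∈ D.supportedIn N ∧
      HasWordLE D.genSet (J * (r * (12 * (D.k M).toNat) + (D.k M).toNat))
        (config h (J * (D.k M).toNat : ℕ)) := by
  induction J generalizing c with
  | zero =>
    have : c = 1 := funext fun x => by
      by_contra h
      have := hc x h
      simp only [zero_mul] at this
      omega
    subst this
    exact ⟨1, rfl, fun _ _ _ => rfl, one_mem _, by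
      simpa [config_one_zero] using HasWordLE.one (S := D.genSet) 0⟩
  | succ J ih =>
    classical
    set z : ℤ := ((J * (D.k M).toNat : ℕ) : ℤ) with hz
    have hz1 : (((J + 1) * (D.k M).toNat : ℕ) : ℤ) = z + D.kz M := by
      rw [hz, kz]; push_cast; ring
    obtain ⟨g, hgM, hg1, hg2, hg3⟩ := ih (c := fun x => if x < D.kz M + z then c x else 1)
      (fun x => by by_cases h : x < D.kz M + z <;> simp [h, hθ])
      (fun x hx => by
        by_cases h : x < D.kz M + z
        · rw [if_pos h] at hx
          have := hc x hx
          omega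
        · simp [h] at hx)
    obtain ⟨f, hfM, hf1, hf2, hf3⟩ := D.exists_block hk hr (y := z) (N := N) (by omega)
      (c := fun x => if x < D.kz M + z then 1 else c x)
      (fun x => by by_cases h : x < D.kz M + z <;> simp [h, hθ])
      (fun x hx => by
        by_cases h : x < D.kz M + z
        · simp [h] at hx
        · rw [if_neg h] at hx
          have := hc x hx
          omega)
    refine ⟨g * f, ?_, fun m x hm => by simp [hg1 m x hm, hf1 m x hm], mul_mem hg2 hf2, ?_⟩
    · funext x
      by_cases h : x < D.kz M + z <;> simp [hgM, hfM, h]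
    · have h1 := hasWordLE_config_mul (hasWordLE_config_mul hg3 hf3)
        (D.hasWordLE_cursor (D.k M).toNat)
      have h2 : translate z (translate (-z) f) = f := by
        funext m x
        simp
      rw [map_one, mul_one, h2, add_zero] at h1
      rw [hz1]
      exact h1.mono (by rw [add_mul]; omega)

/-- Writing elements of `Γ'_M` in the `M`-th lamps at all the positions of `[k_M, N-1]`, by means
of `N / k_M` blocks. -/
theorem exists_level {M : ℕ} (hM : 1 ≤ M) (hk : D.k M ≠ ⊤) {r : ℕ}
    (hr : ∀ γ : Γ M, HasWordLE (Set.range (D.α M) ∪ Set.range (D.β M)) r γ) {N : ℕ}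
    {c : ℤ → Γ M} (hθ : ∀ x, D.thetaHom M (c x) = 1)
    (hc : ∀ x, c x ≠ 1 → D.kz M ≤ x ∧ x < N) :
    ∃ h : ∀ m, ℤ → Γ m, h M = c ∧ (∀ m x, m = 0 ∨ M < m → h m x = 1) ∧ h ∈ D.supportedIn N ∧
      HasWordLE D.genSet (N * (12 * r + 2)) (config h 0) := by
  have hkpos : 0 < (D.k M).toNat := by
    have h := D.one_le_k hM
    rw [← D.coe_toNat_k hk] at h
    exact_mod_cast h
  have hdiv : N / (D.k M).toNat * (D.k M).toNat ≤ N := Nat.div_mul_le_self _ _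
  obtain ⟨h, h1, h2, h3, h4⟩ := D.exists_blocks hk hr (N := N) (N / (D.k M).toNat) hθ
    (fun x hx => by
      have := hc x hx
      have h5 : N < (D.k M).toNat + N / (D.k M).toNat * (D.k M).toNat := by
        have := Nat.lt_div_mul_add (a := N) hkpos
        omega
      refine ⟨this.1, ?_, this.2⟩
      rw [kz]
      omega)
  refine ⟨h, h1, h2, h3, (HasWordLE.cursor_return h4).mono ?_⟩
  calc _ = N / (D.k M).toNat * (D.k M).toNat * (12 * r + 2) := by ring
    _ ≤ _ := Nat.mul_le_mul_right _ hdiv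

/-- A coherent configuration with trivial derived parts is determined by its `0`-th lamps. -/
theorem eq_lampA_mul_lampB {f : ∀ m, ℤ → Γ m} (hf : f ∈ D.coherent)
    (hd : ∀ m, 0 < m → ∀ x, D.derived m (f m x) = 1) :
    f = D.lampA (fun x => (D.thetaHom 0 (f 0 x)).1) *
      D.lampB (fun x => (D.thetaHom 0 (f 0 x)).2) := by
  funext m x
  by_cases hm : D.k m = ⊤
  · simp [lampA_apply_top, lampB_apply_top, hm, hf.1 m hm]
  · have h1 : f m x = D.abelianPart m (f m x) := by
      rcases Nat.eq_zero_or_pos m with rfl | hm0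
      · exact D.eq_abelianPart_zero _
      · exact D.derived_eq_one_iff.1 (hd m hm0 x)
    rw [h1, abelianPart, (hf.2 m hm x).1, (hf.2 m hm x).2]
    simp [lampA_apply, lampB_apply, hm]

/-- Words for coherent configurations whose derived parts vanish above level `M`: the derived
parts are removed level by level, from `M` down to `1`. -/
theorem hasWordLE_config_of_derived {r : ℕ → ℕ} (hr : ∀ m, D.k m ≠ ⊤ → ∀ γ : Γ m,
      HasWordLE (Set.range (D.α m) ∪ Set.range (D.β m)) (r m) γ) {N : ℕ} (M : ℕ)
    {f : ∀ m, ℤ → Γ m} (hf : f ∈ D.coherent) (hfN : f ∈ D.supportedIn N)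
    (hd : ∀ m, M < m → ∀ x, D.derived m (f m x) = 1) :
    HasWordLE D.genSet ((∑ m ∈ Finset.range M, N * (12 * r (m + 1) + 2)) + 6 * N)
      (config f 0) := by
  induction M generalizing f with
  | zero =>
    have hsupp : ∀ x, f 0 x ≠ 1 → 0 ≤ x ∧ x < N := fun x hx => by
      by_contra h
      exact hx (hfN.1 x (by omega))
    have h := D.hasWordLE_lampA_mul_lampB (n := N) (f := fun x => (D.thetaHom 0 (f 0 x)).1)
      (g := fun x => (D.thetaHom 0 (f 0 x)).2)
      (fun x hx => hsupp x fun h => hx (by simp [h]))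
      (fun x hx => hsupp x fun h => hx (by simp [h]))
    rw [← D.eq_lampA_mul_lampB hf hd] at h
    simpa using h
  | succ M ih =>
    have hle : (∑ m ∈ Finset.range M, N * (12 * r (m + 1) + 2)) ≤
        ∑ m ∈ Finset.range (M + 1), N * (12 * r (m + 1) + 2) := by
      rw [Finset.sum_range_succ]; omega
    by_cases hk : D.k (M + 1) = ⊤
    · refine (ih hf hfN fun m hm x => ?_).mono (by omega)
      rcases (show M + 1 ≤ m from hm).eq_or_lt with rfl | h
      · rw [hf.1 _ hk, derived_one]
      · exact hd m h x
    · obtain ⟨h, h1, h2, h3, h4⟩ := D.exists_level (M := M + 1) (by omega) hk (hr _ hk) (N := N)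
        (c := fun x => D.derived (M + 1) (f (M + 1) x)) (fun x => D.thetaHom_derived _ _)
        (fun x hx => by
          have h5 := hfN.2 _ hk x
          refine ⟨?_, ?_⟩ <;> by_contra h
          · exact hx (D.derived_of_mem_range_α (h5.1 (by omega)))
          · exact hx (D.derived_of_mem_range_β (h5.2 (by omega))))
      have hcoh : h ∈ D.coherent := D.lamps_mem_coherent h4.mem_closure
      have h6 := hasWordLE_config_mul h4 (ih (mul_mem (inv_mem hcoh) hf)
        (mul_mem (inv_mem h3) hfN) fun m hm x => by
          rcases (show M + 1 ≤ m from hm).eq_or_lt with rfl | hm'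
          · simp only [Pi.mul_apply, Pi.inv_apply, h1]
            rw [inv_derived_mul, derived_abelianPart]
          · simpa [h2 m x (Or.inr hm')] using hd m hm' x)
      rw [translate_zero, mul_inv_cancel_left, add_zero] at h6
      refine h6.mono ?_
      rw [Finset.sum_range_succ]
      omega

/-- Above the level of `N - 1` nothing is to be written besides abelian parts. -/
theorem derived_of_level_lt {N : ℕ} (hN : 1 ≤ N) {f : ∀ m, ℤ → Γ m} (hf : f ∈ D.coherent)
    (hfN : f ∈ D.supportedIn N) {m : ℕ} (hm : D.level (N - 1) < m) (x : ℤ) :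
    D.derived m (f m x) = 1 := by
  by_cases hk : D.k m = ⊤
  · rw [hf.1 m hk, derived_one]
  · have h1 : ¬ D.kz m < N := by rw [← D.le_level_pred_iff hN hk]; omega
    by_cases h2 : x < D.kz m
    · exact D.derived_of_mem_range_α ((hfN.2 m hk x).1 h2)
    · exact D.derived_of_mem_range_β ((hfN.2 m hk x).2 (by omega))

theorem hasWordLE_config {r : ℕ → ℕ} (hr : ∀ m, D.k m ≠ ⊤ → ∀ γ : Γ m,
      HasWordLE (Set.range (D.α m) ∪ Set.range (D.β m)) (r m) γ) {N : ℕ}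
    {f : ∀ m, ℤ → Γ m} (hf : f ∈ D.coherent) (hfN : f ∈ D.supportedIn N) {t : ℤ}
    (ht0 : 0 ≤ t) (htN : t < N) :
    HasWordLE D.genSet
      ((∑ m ∈ Finset.range (D.level (N - 1)), N * (12 * r (m + 1) + 2)) + 7 * N)
      (config f t) := by
  have h1 := D.hasWordLE_config_of_derived hr (D.level (N - 1)) hf hfN fun m hm x =>
    D.derived_of_level_lt (by omega) hf hfN hm x
  have h2 := hasWordLE_config_mul h1 (D.hasWordLE_cursor t.toNat)
  rw [map_one, mul_one, zero_add, Int.toNat_of_nonneg ht0] at h2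
  exact h2.mono (by omega)

/-! ### Elements with a prescribed range -/

theorem cursor_one : cursor (1 : D.Delta) = 0 := rfl

variable {D} in
theorem cursor_mul (δ ε : D.Delta) : cursor (δ * ε) = cursor δ + cursor ε := rfl

variable {D} in
theorem cursor_inv (δ : D.Delta) : cursor δ⁻¹ = -cursor δ := rfl

variable {D} in
theorem lamps_coe_mul (δ ε : D.Delta) :
    lamps (δ * ε).1 = lamps δ.1 * translate (cursor δ) (lamps ε.1) := lamps_mul δ.1 ε.1

variable {D} in
theorem lamps_coe_inv (δ : D.Delta) :
    lamps (δ⁻¹).1 = (translate (-cursor δ) (lamps δ.1))⁻¹ := lamps_inv δ.1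

variable {D} in
theorem delta_ext {δ ε : D.Delta} (h : lamps δ.1 = lamps ε.1) (h' : cursor δ = cursor ε) :
    δ = ε := by
  apply Subtype.ext
  rw [← config_lamps δ.1, h]
  change config _ (cursor δ) = _
  rw [h']
  rfl

theorem lamps_coherent (δ : D.Delta) : lamps δ.1 ∈ D.coherent := D.lamps_mem_coherent δ.2

/-- The elements of `Δ` whose lamps are supported in `[0, N-1]`, in the sense of `supportedIn`, and
whose cursor lies in this interval. This is the intrinsic description of `F_N`. -/
def box (N : ℕ) : Set D.Delta :=
  {δ | lamps δ.1 ∈ D.supportedIn N ∧ 0 ≤ cursor δ ∧ cursor δ < N}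

theorem one_mem_box {N : ℕ} (hN : 1 ≤ N) : (1 : D.Delta) ∈ D.box N :=
  ⟨one_mem _, le_rfl, by rw [cursor_one]; exact_mod_cast hN⟩

theorem mem_genDelta_iff {s : D.Delta} : s ∈ D.genDelta ↔
    s.1 = genT ∨ (∃ a, D.genA a = s.1) ∨ ∃ b, D.genB b = s.1 := by
  change s.1 ∈ D.genSet ↔ _
  simp [genSet, or_assoc]

/-- The letters of words over `S_Δ` either only move the cursor, or write at the cursor. -/
theorem letter_cases {s : D.Delta} (hs : s ∈ D.genDelta ∪ D.genDelta⁻¹) :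
    lamps s.1 = 1 ∨ (cursor s = 0 ∧ ((∃ a, lamps s.1 = D.lampA (Pi.mulSingle 0 a)) ∨
      ∃ b, lamps s.1 = D.lampB (Pi.mulSingle 0 b))) := by
  have key : ∀ s ∈ D.genDelta, lamps s.1 = 1 ∨ (cursor s = 0 ∧
      ((∃ a, lamps s.1 = D.lampA (Pi.mulSingle 0 a)) ∨
        ∃ b, lamps s.1 = D.lampB (Pi.mulSingle 0 b))) := by
    intro s hs
    rcases D.mem_genDelta_iff.1 hs with h | ⟨a, h⟩ | ⟨b, h⟩
    · left; rw [h]; rfl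
    · right
      refine ⟨?_, Or.inl ⟨a, ?_⟩⟩
      · rw [cursor, ← h]; rfl
      · rw [← h, genA_eq, lamps_config]
    · right
      refine ⟨?_, Or.inr ⟨b, ?_⟩⟩
      · rw [cursor, ← h]; rfl
      · rw [← h, genB_eq, lamps_config]
  rcases hs with hs | hs
  · exact key s hs
  · rw [← inv_inv s, cursor_inv, lamps_coe_inv]
    rcases key _ hs with h | ⟨h0, ⟨a, h⟩ | ⟨b, h⟩⟩
    · left; rw [h, map_one, inv_one]
    · right
      refine ⟨by rw [h0, neg_zero], Or.inl ⟨a⁻¹, ?_⟩⟩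
      rw [h0, h, neg_zero, translate_zero, ← map_inv, Pi.mulSingle_inv]
    · right
      refine ⟨by rw [h0, neg_zero], Or.inr ⟨b⁻¹, ?_⟩⟩
      rw [h0, h, neg_zero, translate_zero, ← map_inv, Pi.mulSingle_inv]

/-- Appending a letter does not leave the box as long as the cursor remains in the interval. -/
theorem mul_letter_mem_box {N : ℕ} {δ s : D.Delta} (hδ : δ ∈ D.box N)
    (hs : s ∈ D.genDelta ∪ D.genDelta⁻¹) (h0 : 0 ≤ cursor (δ * s)) (hN : cursor (δ * s) < N) :
    δ * s ∈ D.box N := by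
  refine ⟨?_, h0, hN⟩
  obtain ⟨hδ1, hδ2, hδ3⟩ := hδ
  rw [lamps_coe_mul]
  refine mul_mem hδ1 ?_
  rcases D.letter_cases hs with h | ⟨-, ⟨a, h⟩ | ⟨b, h⟩⟩
  · rw [h, map_one]; exact one_mem _
  · rw [h, translate_lampA]
    refine D.lampA_mem_supportedIn fun x hx => ?_
    by_cases hx0 : x - cursor δ = 0
    · omega
    · simp [hx0] at hx
  · rw [h, translate_lampB]
    refine D.lampB_mem_supportedIn fun x hx => ?_
    by_cases hx0 : x - cursor δ = 0
    · omega
    · simp [hx0] at hx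

theorem F_subset_box (N : ℕ) : D.F N ⊆ D.box N := by
  rintro δ ⟨w, hw, rfl, hr⟩
  have hcur : ∀ i ≤ w.length, 0 ≤ cursor (w.take i).prod ∧ cursor (w.take i).prod < N :=
    fun i hi => hr ⟨i, hi, rfl⟩
  have key : ∀ i ≤ w.length, (w.take i).prod ∈ D.box N := by
    intro i
    induction i with
    | zero =>
      intro _
      have := hcur 0 (Nat.zero_le _)
      exact D.one_mem_box (by omega)
    | succ i ih =>
      intro hi
      have h := hcur (i + 1) hi
      rw [List.prod_take_succ w i hi] at h ⊢
      exact D.mul_letter_mem_box (ih (by omega)) (hw _ (List.getElem_mem _)) h.1 h.2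
  simpa using key w.length le_rfl

theorem comp_eq_mulSingle {G M : Type*} [Group G] [Group M] (φ : G →* M) {f : ℤ → G}
    (h : ∀ x ≠ 0, f x = 1) : (fun x => φ (f x)) = Pi.mulSingle 0 (φ (f 0)) := by
  funext x
  by_cases hx : x = 0
  · subst hx; simp
  · simp [hx, h x hx]

theorem F_one_eq_box : D.F 1 = D.box 1 := by
  refine (D.F_subset_box 1).antisymm ?_
  rintro δ ⟨hδ1, hδ2, hδ3⟩
  have hδ0 : cursor δ = 0 := by push_cast at hδ3; omega
  have hf := D.eq_lampA_mul_lampB (D.lamps_coherent δ) fun m hm x =>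
    D.derived_of_level_lt le_rfl (D.lamps_coherent δ) hδ1 (m := m) (by
      by_contra h
      have h1 := (D.le_level_iff m _).1 (not_lt.1 h)
      have h2 := (D.one_le_k hm).trans h1
      simp at h2) x
  have h0 : ∀ x ≠ 0, lamps δ.1 0 x = 1 := fun x hx => hδ1.1 x (by push_cast; omega)
  have hA := comp_eq_mulSingle ((MonoidHom.fst A B).comp (D.thetaHom 0)) h0
  have hB := comp_eq_mulSingle ((MonoidHom.snd A B).comp (D.thetaHom 0)) h0
  simp only [MonoidHom.comp_apply, MonoidHom.coe_fst, MonoidHom.coe_snd] at hA hB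
  rw [hA, hB] at hf
  set a := (D.thetaHom 0 (lamps δ.1 0 0)).1
  set b := (D.thetaHom 0 (lamps δ.1 0 0)).2
  let sA : D.Delta := ⟨D.genA a, Subgroup.subset_closure (D.genA_mem a)⟩
  let sB : D.Delta := ⟨D.genB b, Subgroup.subset_closure (D.genB_mem b)⟩
  have hsA : sA ∈ D.genDelta := D.genA_mem a
  have hsB : sB ∈ D.genDelta := D.genB_mem b
  have hcA : cursor sA = 0 := rfl
  have hcB : cursor sB = 0 := rfl
  refine ⟨[sA, sB], ?_, ?_, ?_⟩
  · intro s hs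
    rcases List.mem_pair.1 hs with rfl | rfl
    exacts [Or.inl hsA, Or.inl hsB]
  · have hlA : lamps sA.1 = D.lampA (Pi.mulSingle 0 a) := by
      rw [← lamps_config (D.lampA (Pi.mulSingle 0 a)) 0, ← genA_eq]
    have hlB : lamps sB.1 = D.lampB (Pi.mulSingle 0 b) := by
      rw [← lamps_config (D.lampB (Pi.mulSingle 0 b)) 0, ← genB_eq]
    rw [List.prod_pair]
    refine delta_ext ?_ (by rw [cursor_mul, hcA, hcB, hδ0, add_zero])
    rw [lamps_coe_mul, hcA, translate_zero, hf, hlA, hlB]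
  · rintro x ⟨i, hi, rfl⟩
    have : cursor (List.take i [sA, sB]).prod = 0 := by
      rcases i with - | - | i
      · rfl
      · simp [hcA]
      · simp [cursor_mul, hcA, hcB]
    rw [this]
    simp

/-! ### The tiles -/

/-- A coherent configuration supported in `[0, K-1]` is determined by the lamps at the positions
in `[k_m, K-1]`. -/
theorem eq_of_eqOn {K : ℕ} {f g : ∀ m, ℤ → Γ m} (hf : f ∈ D.coherent) (hg : g ∈ D.coherent)
    (hfK : f ∈ D.supportedIn K) (hgK : g ∈ D.supportedIn K)
    (h : ∀ m, D.k m ≠ ⊤ → ∀ x, D.kz m ≤ x → x < K → f m x = g m x) : f = g := by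
  have h0 : ∀ x, f 0 x = g 0 x := fun x => by
    by_cases hx : 0 ≤ x ∧ x < K
    · exact h 0 D.k_zero_ne_top x (by simpa using hx.1) hx.2
    · rw [hfK.1 x (by omega), hgK.1 x (by omega)]
  funext m x
  by_cases hm : D.k m = ⊤
  · rw [hf.1 m hm, hg.1 m hm]
  · by_cases hx : x < D.kz m
    · rw [(D.eq_of_mem_range_α ((hfK.2 m hm x).1 hx)).1,
        (D.eq_of_mem_range_α ((hgK.2 m hm x).1 hx)).1, (hf.2 m hm x).1, (hg.2 m hm x).1, h0]
    · by_cases hx' : x < K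
      · exact h m hm x (by omega) hx'
      · rw [(D.eq_of_mem_range_β ((hfK.2 m hm x).2 (by omega))).1,
          (D.eq_of_mem_range_β ((hgK.2 m hm x).2 (by omega))).1, (hf.2 m hm x).2,
          (hg.2 m hm x).2, h0]

/-- The lamps at the positions in the blocks `[P + k_m, P + K - 1]` extend to a coherent
configuration which is supported in `[0, K-1]` after translation by `-P`. -/
theorem exists_restrict (K : ℕ) (P : ℤ) {g : ∀ m, ℤ → Γ m} (hg : g ∈ D.coherent) :
    ∃ f ∈ D.coherent, f ∈ D.supportedIn K ∧
      ∀ m, D.k m ≠ ⊤ → ∀ x, P + D.kz m ≤ x → x < P + K → f m (x - P) = g m x := by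
  classical
  set a : ℤ → A := fun x => if 0 ≤ x ∧ x < K then (D.thetaHom 0 (g 0 (x + P))).1 else 1 with ha
  set b : ℤ → B := fun x => if 0 ≤ x ∧ x < K then (D.thetaHom 0 (g 0 (x + P))).2 else 1 with hb
  have hA : ∀ x, a x ≠ 1 → 0 ≤ x ∧ x < K := fun x hx => by
    by_contra h
    exact hx (if_neg h)
  have hB : ∀ x, b x ≠ 1 → 0 ≤ x ∧ x < K := fun x hx => by
    by_contra h
    exact hx (if_neg h)
  set e := D.lampA a * D.lampB b with he
  have heC : e ∈ D.coherent := mul_mem (D.lampA_mem_coherent a) (D.lampB_mem_coherent b)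
  have heK : e ∈ D.supportedIn K :=
    mul_mem (D.lampA_mem_supportedIn hA) (D.lampB_mem_supportedIn hB)
  have heθ : ∀ m, D.k m ≠ ⊤ → ∀ x, D.thetaHom m (e m x) = (a x, b (x - D.kz m)) :=
    fun m hm x => by simp [he, lampA_apply, lampB_apply, hm]
  set f : ∀ m, ℤ → Γ m := fun m x =>
    if D.k m ≠ ⊤ ∧ D.kz m ≤ x ∧ x < K then g m (x + P) else e m x with hf
  -- Replacing `e` by `g` in the blocks does not change the abelian parts.
  have hfθ : ∀ m, D.k m ≠ ⊤ → ∀ x, D.thetaHom m (f m x) = D.thetaHom m (e m x) := by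
    intro m hm x
    by_cases h : D.kz m ≤ x ∧ x < K
    · have hk := D.kz_nonneg m
      rw [heθ m hm, hf]
      simp only [if_pos (show D.k m ≠ ⊤ ∧ D.kz m ≤ x ∧ x < K from ⟨hm, h⟩), ha, hb]
      rw [if_pos (by omega), if_pos (by omega)]
      have h2 := hg.2 m hm (x + P)
      refine Prod.ext h2.1 ?_
      rw [h2.2, sub_add_eq_add_sub]
    · have : f m x = e m x := if_neg fun h' => h h'.2
      rw [this]
  refine ⟨f, ⟨fun m hm x => ?_, fun m hm x => ?_⟩, ⟨fun x hx => ?_, fun m hm x => ⟨fun hx => ?_,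
    fun hx => ?_⟩⟩, fun m hm x hx1 hx2 => ?_⟩
  · have : f m x = e m x := if_neg fun h' => h'.1 hm
    rw [this, heC.1 m hm]
  · rw [hfθ m hm, hfθ 0 D.k_zero_ne_top, hfθ 0 D.k_zero_ne_top]
    exact heC.2 m hm x
  · have : f 0 x = e 0 x := if_neg fun h' => by
      have := h'.2
      rw [kz_zero] at this
      omega
    rw [this, heK.1 x hx]
  · have : f m x = e m x := if_neg fun h' => by omega
    rw [this]
    exact (heK.2 m hm x).1 hx
  · have : f m x = e m x := if_neg fun h' => by omega
    rw [this]
    exact (heK.2 m hm x).2 hx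
  · have : f m (x - P) = g m (x - P + P) := if_pos ⟨hm, by omega, by omega⟩
    rw [this, sub_add_cancel]

theorem le_bigLevel_iff {m : ℕ} (n : ℕ) (hm : D.k m ≠ ⊤) :
    m ≤ D.bigLevel n ↔ D.kz m < (D.κ : ℤ) ^ n := by
  rw [bigLevel, D.le_level_pred_iff (D.κ_pow_pos n) hm]
  push_cast
  rfl

/-- The blocks `[j κ^n, (j+1) κ^n - 1]` lie in `[0, κ^(n+1) - 1]`. -/
theorem block_le {n j : ℕ} (hj : j < D.κ) :
    (j : ℤ) * (D.κ : ℤ) ^ n + (D.κ : ℤ) ^ n ≤ (D.κ : ℤ) ^ (n + 1) := by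
  have h : ((j : ℤ) + 1) ≤ D.κ := by exact_mod_cast hj
  have := mul_le_mul_of_nonneg_right h (by positivity : 0 ≤ (D.κ : ℤ) ^ n)
  rw [pow_succ]
  linarith

/-- The shift `Σ^j_{n+1}` in terms of lamps instead of their derived parts: an element of it is
supported in `[0, κ^(n+1) - 1]`, and its `m`-th lamps are trivial on
`[j κ^n + k_m, (j+1) κ^n - 1]`. This interval is empty if `m > 𝔏(n)`, so that the cases of the
definition need not be distinguished. -/
theorem mem_shiftPart_iff {n j : ℕ} (hj : j < D.κ) {σ : D.Delta} : σ ∈ D.shiftPart n j ↔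
    cursor σ = j * (D.κ : ℤ) ^ n ∧ lamps σ.1 ∈ D.supportedIn ((D.κ : ℤ) ^ (n + 1)) ∧
      ∀ m, D.k m ≠ ⊤ → ∀ x, j * (D.κ : ℤ) ^ n + D.kz m ≤ x →
        x < j * (D.κ : ℤ) ^ n + (D.κ : ℤ) ^ n → lamps σ.1 m x = 1 := by
  have hQ := D.block_le (n := n) hj
  have hK : 0 < (D.κ : ℤ) ^ n := by exact_mod_cast D.κ_pow_pos n
  have hP : 0 ≤ (j : ℤ) * (D.κ : ℤ) ^ n := by positivity
  have hcoh := D.lamps_coherent σ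
  have hlev := fun m => D.le_bigLevel_iff (m := m) n
  have hlev' := fun m => D.le_bigLevel_iff (m := m) (n + 1)
  simp only [shiftPart, Set.mem_ofPred_eq, add_mul, one_mul]
  change _ ∧ Function.mulSupport (lamps σ.1 0) ⊆ _ ∧ _ ↔ _
  generalize (D.κ : ℤ) ^ (n + 1) = Q at *
  generalize (D.κ : ℤ) ^ n = K at *
  generalize (j : ℤ) * K = P at *
  refine and_congr_right fun _ => ⟨?_, ?_⟩
  · rintro ⟨h0, h1, h2, h3⟩
    have hz : ∀ x, x < 0 ∨ Q ≤ x ∨ (P ≤ x ∧ x < P + K) → lamps σ.1 0 x = 1 := fun x hx => by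
      by_contra h
      rcases h0 h with h' | h' <;> rw [Set.mem_Icc] at h' <;> omega
    have hd : ∀ m, 1 ≤ m → D.k m ≠ ⊤ → ∀ x,
        x < D.kz m ∨ Q ≤ x ∨ (P + D.kz m ≤ x ∧ x < P + K) → D.derived m (lamps σ.1 m x) = 1 := by
      intro m hm hmt x hx
      by_contra h
      have h' : x ∈ Function.mulSupport (lampDerived σ m) := h
      have hl := hlev m hmt
      have hl' := hlev' m hmt
      by_cases hm1 : m ≤ D.bigLevel n
      · rcases h1 m hm hm1 h' with h' | h' <;> rw [Set.mem_Icc] at h' <;> omega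
      · by_cases hm2 : m ≤ D.bigLevel (n + 1)
        · have h' := h2 m (by omega) hm2 h'
          rw [Set.mem_Icc] at h'
          omega
        · rw [h3 m (by omega)] at h'
          exact h'
    have hA : ∀ m, D.k m ≠ ⊤ → ∀ x, x < 0 ∨ Q ≤ x ∨ (P ≤ x ∧ x < P + K) →
        (D.thetaHom m (lamps σ.1 m x)).1 = 1 := fun m hmt x hx => by
      rw [(hcoh.2 m hmt x).1, hz x hx, map_one]
      rfl
    have hB : ∀ m, D.k m ≠ ⊤ → ∀ x, x - D.kz m < 0 ∨ Q ≤ x - D.kz m ∨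
        (P ≤ x - D.kz m ∧ x - D.kz m < P + K) →
        (D.thetaHom m (lamps σ.1 m x)).2 = 1 := fun m hmt x hx => by
      rw [(hcoh.2 m hmt x).2, hz _ hx, map_one]
      rfl
    have hab : ∀ m, D.k m ≠ ⊤ → ∀ x, x < D.kz m ∨ Q ≤ x ∨ (P + D.kz m ≤ x ∧ x < P + K) →
        lamps σ.1 m x = D.abelianPart m (lamps σ.1 m x) := fun m hmt x hx => by
      rcases Nat.eq_zero_or_pos m with rfl | hm
      · exact D.eq_abelianPart_zero _
      · exact D.derived_eq_one_iff.1 (hd m hm hmt x hx)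
    refine ⟨⟨fun x hx => hz x (by omega), fun m hmt x => ⟨fun hx => ?_, fun hx => ?_⟩⟩,
      fun m hmt x hx1 hx2 => ?_⟩
    · rw [hab m hmt x (Or.inl hx), abelianPart, hB m hmt x (by omega)]
      exact ⟨_, by simp; rfl⟩
    · rw [hab m hmt x (by omega), abelianPart, hA m hmt x (by omega)]
      exact ⟨_, by simp; rfl⟩
    · have := D.kz_nonneg m
      rw [hab m hmt x (by omega), abelianPart, hA m hmt x (by omega), hB m hmt x (by omega)]
      simp
  · rintro ⟨hs, h1⟩
    have hd : ∀ m, D.k m ≠ ⊤ → ∀ x, D.derived m (lamps σ.1 m x) ≠ 1 →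
        D.kz m ≤ x ∧ x < Q ∧ ¬ (P + D.kz m ≤ x ∧ x < P + K) := by
      intro m hmt x hx
      refine ⟨?_, ?_, ?_⟩ <;> by_contra h
      · exact hx (D.derived_of_mem_range_α ((hs.2 m hmt x).1 (by omega)))
      · exact hx (D.derived_of_mem_range_β ((hs.2 m hmt x).2 (by omega)))
      · exact hx (by rw [h1 m hmt x h.1 h.2, derived_one])
    have htop : ∀ m x, D.derived m (lamps σ.1 m x) ≠ 1 → D.k m ≠ ⊤ := fun m x hx hmt =>
      hx (by rw [hcoh.1 m hmt, derived_one])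
    refine ⟨fun x hx => ?_, fun m _ hm x hx => ?_, fun m hm hm' x hx => ?_, fun m hm => ?_⟩
    · have hx1 : 0 ≤ x ∧ x < Q := by
        by_contra h
        exact hx (hs.1 x (by omega))
      have hx2 : ¬ (P ≤ x ∧ x < P + K) := fun h =>
        hx (h1 0 D.k_zero_ne_top x (by rw [kz_zero]; omega) h.2)
      rw [Set.mem_union, Set.mem_Icc, Set.mem_Icc]
      omega
    · have := hd m (htop m x hx) x hx
      rw [Set.mem_union, Set.mem_Icc, Set.mem_Icc]
      omega
    · have := hd m (htop m x hx) x hx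
      rw [Set.mem_Icc]
      omega
    · refine Set.eq_empty_iff_forall_notMem.2 fun x hx => ?_
      have h2 := hd m (htop m x hx) x hx
      have h3 := hlev' m (htop m x hx)
      omega

/-! ### Geometric sums and the length of words -/

theorem exists_geometric_bound : ∃ q : ℝ, 1 < q ∧ (∀ m, D.k m ≠ ⊤ → 0 < D.l m) ∧
    ∀ m, D.k (m + 1) ≠ ⊤ → q * D.l m ≤ D.l (m + 1) := by
  obtain ⟨l₀, q, hl₀, hq, e, he, hl⟩ := D.l_geometric
  refine ⟨q, hq, fun m hm => by rw [hl m hm]; positivity, fun m hm => ?_⟩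
  rw [hl _ hm, hl m (D.k_ne_top_of_le (Nat.le_succ m) hm)]
  have : q ^ (e m + 1) ≤ q ^ e (m + 1) :=
    pow_le_pow_right₀ hq.le (he (Nat.lt_succ_self m))
  calc q * (l₀ * q ^ e m) = l₀ * q ^ (e m + 1) := by ring
    _ ≤ _ := by gcongr

/-- The sum of the `l_m` up to a given level is comparable to its last term. -/
theorem exists_sum_l_le : ∃ C : ℝ, 0 < C ∧ ∀ M, D.k M ≠ ⊤ →
    ∑ m ∈ Finset.range (M + 1), D.l m ≤ C * D.l M := by
  obtain ⟨q, hq, hpos, hle⟩ := D.exists_geometric_bound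
  have hq1 : 0 < q - 1 := by linarith
  refine ⟨q / (q - 1), by positivity, fun M => ?_⟩
  induction M with
  | zero =>
    intro h
    have h1 : 1 ≤ q / (q - 1) := by rw [le_div_iff₀ hq1]; linarith
    simpa using le_mul_of_one_le_left (hpos 0 h).le h1
  | succ M ih =>
    intro h
    rw [Finset.sum_range_succ]
    have h1 := ih (D.k_ne_top_of_le (Nat.le_succ M) h)
    have h2 : q / (q - 1) * D.l M ≤ 1 / (q - 1) * D.l (M + 1) := by
      rw [div_mul_eq_mul_div, div_mul_eq_mul_div, one_mul]
      exact div_le_div_of_nonneg_right (hle M h) hq1.le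
    have h3 : q / (q - 1) = 1 / (q - 1) + 1 := by field_simp; ring
    calc _ ≤ 1 / (q - 1) * D.l (M + 1) + D.l (M + 1) := by linarith
      _ = _ := by rw [h3]; ring

theorem l_zero_le {m : ℕ} (hm : D.k m ≠ ⊤) : D.l 0 ≤ D.l m := by
  obtain ⟨q, hq, hpos, hle⟩ := D.exists_geometric_bound
  induction m with
  | zero => exact le_rfl
  | succ m ih =>
    have hm' := D.k_ne_top_of_le (Nat.le_succ m) hm
    have := hpos m hm'
    have h1 := hle m hm
    nlinarith [ih hm']

/-- The diameter bounds for the groups `Γ_m`, in terms of words. -/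
theorem exists_hasWordLE_Γ : ∃ c : ℝ, 0 < c ∧ ∃ r : ℕ → ℕ, ∀ m, D.k m ≠ ⊤ →
    (r m : ℝ) ≤ c * D.l m ∧
      ∀ γ : Γ m, HasWordLE (Set.range (D.α m) ∪ Set.range (D.β m)) (r m) γ := by
  obtain ⟨c, hc, h⟩ := D.diam_bound
  obtain ⟨-, -, hpos, -⟩ := D.exists_geometric_bound
  refine ⟨c, hc, fun m =>
    (wordDiam (Set.range (D.α m) ∪ Set.range (D.β m)) Set.univ).toNat, fun m hm => ?_⟩
  have h2 := (h m hm).2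
  have hne : wordDiam (Set.range (D.α m) ∪ Set.range (D.β m)) Set.univ ≠ ⊤ := by
    intro htop
    rw [htop] at h2
    simp at h2
  have hcoe := ENat.natCast_toNat hne
  refine ⟨?_, fun γ => hasWordLE_of_wordDiam_le hcoe.ge γ⟩
  rw [← hcoe] at h2
  have h3 := ENNReal.toReal_mono ENNReal.ofReal_ne_top h2
  rw [ENNReal.toReal_ofReal (mul_nonneg hc.le (hpos m hm).le)] at h3
  simpa using h3

/-- Every element of a box has a word of the expected length. The same words show that any
coherent configuration supported in an interval, with any position of the cursor in this interval,
comes from an element of `Δ`. -/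
theorem exists_hasWordLE_config : ∃ C : ℝ, 0 < C ∧ ∀ N : ℕ, 1 ≤ N → ∃ n : ℕ,
    ((2 * n : ℕ) : ℝ) ≤ C * N * D.l (D.level (N - 1)) ∧
    ∀ f ∈ D.coherent, f ∈ D.supportedIn N → ∀ t : ℤ, 0 ≤ t → t < N →
      HasWordLE D.genSet n (config f t) := by
  obtain ⟨c, hc, r, hr⟩ := D.exists_hasWordLE_Γ
  obtain ⟨C, hC, hsum⟩ := D.exists_sum_l_le
  obtain ⟨-, -, hpos, -⟩ := D.exists_geometric_bound
  have hl0 := hpos 0 D.k_zero_ne_top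
  -- The constants `2` and `7` in the word lengths are absorbed using `l 0 ≤ l m`.
  refine ⟨2 * ((12 * c + 2 / D.l 0) * C + 7 / D.l 0), by positivity, fun N hN => ⟨_, ?_,
    fun f hf hfN t ht0 htN => D.hasWordLE_config (fun m hm => (hr m hm).2) hf hfN ht0 htN⟩⟩
  have hL := D.k_level_ne_top (N - 1)
  set L := D.level (N - 1)
  have hterm : ∀ m ∈ Finset.range L,
      (N : ℝ) * (12 * r (m + 1) + 2) ≤ N * ((12 * c + 2 / D.l 0) * D.l (m + 1)) := by
    intro m hm
    have hm' := D.k_ne_top_of_le (Finset.mem_range.1 hm) hL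
    have h1 := (hr (m + 1) hm').1
    have h2 : 2 ≤ 2 / D.l 0 * D.l (m + 1) := by
      rw [div_mul_eq_mul_div, le_div_iff₀ hl0]
      linarith [D.l_zero_le hm']
    gcongr
    linarith
  have h3 : ∑ m ∈ Finset.range L, D.l (m + 1) ≤ C * D.l L := by
    have := hsum L hL
    rw [Finset.sum_range_succ'] at this
    linarith
  have h7 : 7 ≤ 7 / D.l 0 * D.l L := by
    rw [div_mul_eq_mul_div, le_div_iff₀ hl0]
    linarith [D.l_zero_le hL]
  have h4 := Finset.sum_le_sum hterm
  rw [← Finset.mul_sum, ← Finset.mul_sum, ← Finset.mul_sum] at h4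
  have h5 : (N : ℝ) * ((12 * c + 2 / D.l 0) * ∑ m ∈ Finset.range L, D.l (m + 1)) ≤
      N * ((12 * c + 2 / D.l 0) * (C * D.l L)) := by gcongr
  have h6 : (7 : ℝ) * N ≤ N * (7 / D.l 0 * D.l L) := by
    rw [mul_comm]
    gcongr
  push_cast
  rw [← Finset.mul_sum]
  calc _ ≤ 2 * (N * ((12 * c + 2 / D.l 0) * (C * D.l L)) + N * (7 / D.l 0 * D.l L)) := by
        linarith
    _ = _ := by ring

theorem exists_mem_box {N : ℕ} {f : ∀ m, ℤ → Γ m} (hf : f ∈ D.coherent)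
    (hfN : f ∈ D.supportedIn N) {t : ℤ} (ht0 : 0 ≤ t) (htN : t < N) :
    ∃ δ ∈ D.box N, lamps δ.1 = f ∧ cursor δ = t := by
  obtain ⟨C, -, h⟩ := D.exists_hasWordLE_config
  obtain ⟨n, -, hn⟩ := h N (by omega)
  exact ⟨⟨config f t, (hn f hf hfN t ht0 htN).mem_closure⟩, ⟨hfN, ht0, htN⟩, rfl, rfl⟩

theorem exists_hasWordLE_box : ∃ C : ℝ, 0 < C ∧ ∀ N : ℕ, 1 ≤ N → ∃ n : ℕ,
    ((2 * n : ℕ) : ℝ) ≤ C * N * D.l (D.level (N - 1)) ∧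
    ∀ δ ∈ D.box N, HasWordLE D.genDelta n δ := by
  obtain ⟨C, hC, h⟩ := D.exists_hasWordLE_config
  refine ⟨C, hC, fun N hN => ?_⟩
  obtain ⟨n, hn, hw⟩ := h N hN
  exact ⟨n, hn, fun δ hδ =>
    (hw _ (D.lamps_coherent δ) hδ.1 _ hδ.2.1 hδ.2.2).subgroup_closure⟩

theorem finite_genDelta [Finite A] [Finite B] : D.genDelta.Finite := by
  have h : D.genSet.Finite :=
    ((Set.finite_singleton _).union (Set.finite_range _)).union (Set.finite_range _)
  exact h.preimage Subtype.val_injective.injOn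

theorem finite_box [Finite A] [Finite B] {N : ℕ} (hN : 1 ≤ N) : (D.box N).Finite := by
  obtain ⟨C, -, h⟩ := D.exists_hasWordLE_box
  obtain ⟨n, -, hn⟩ := h N hN
  exact (finite_setOf_hasWordLE D.finite_genDelta n).subset hn

/-! ### The tiling -/

/-- In a product of an element of the shift by an element of the box, the latter is determined by
the product, because its lamps in `[k_m, κ^n - 1]` appear unchanged in it. -/
theorem mul_eq_mul_of_mem_shiftPart {n i j : ℕ} (hi : i < D.κ) (hj : j < D.κ)
    {σ σ' τ τ' : D.Delta} (hσ : σ ∈ D.shiftPart n i) (hσ' : σ' ∈ D.shiftPart n j)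
    (hτ : τ ∈ D.box (D.κ ^ n)) (hτ' : τ' ∈ D.box (D.κ ^ n)) (h : σ * τ = σ' * τ') : σ = σ' := by
  obtain ⟨hc, -, h1⟩ := (D.mem_shiftPart_iff hi).1 hσ
  obtain ⟨hc', -, h1'⟩ := (D.mem_shiftPart_iff hj).1 hσ'
  have hcur := congrArg cursor h
  rw [cursor_mul, cursor_mul, hc, hc'] at hcur
  have hK : (0 : ℤ) < (D.κ : ℤ) ^ n := by exact_mod_cast D.κ_pow_pos n
  have ht := hτ.2
  have ht' := hτ'.2
  push_cast at ht ht'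
  obtain rfl : i = j := by
    have e1 : (cursor τ + i * (D.κ : ℤ) ^ n) / (D.κ : ℤ) ^ n = i := by
      rw [Int.add_mul_ediv_right _ _ hK.ne', Int.ediv_eq_zero_of_lt ht.1 ht.2, zero_add]
    have e2 : (cursor τ' + j * (D.κ : ℤ) ^ n) / (D.κ : ℤ) ^ n = j := by
      rw [Int.add_mul_ediv_right _ _ hK.ne', Int.ediv_eq_zero_of_lt ht'.1 ht'.2, zero_add]
    rw [add_comm, hcur, add_comm, e2] at e1
    exact_mod_cast e1.symm
  have hl := congrArg (fun δ : D.Delta => lamps δ.1) h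
  simp only [lamps_coe_mul, hc, hc'] at hl
  have hττ' : τ = τ' := by
    refine delta_ext (D.eq_of_eqOn (K := D.κ ^ n) (D.lamps_coherent τ) (D.lamps_coherent τ')
      hτ.1 hτ'.1 fun m hm x hx1 hx2 => ?_) (by omega)
    push_cast at hx2
    have h2 := congrFun (congrFun hl m) (x + i * (D.κ : ℤ) ^ n)
    simp only [Pi.mul_apply, translate_apply, add_sub_cancel_right] at h2
    rwa [h1 m hm _ (by omega) (by omega), h1' m hm _ (by omega) (by omega), one_mul,
      one_mul] at h2
  rw [hττ'] at h
  exact mul_right_cancel h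

theorem shift_mul_box (n : ℕ) : D.shift (n + 1) * D.box (D.κ ^ n) = D.box (D.κ ^ (n + 1)) := by
  have hK : (0 : ℤ) < (D.κ : ℤ) ^ n := by exact_mod_cast D.κ_pow_pos n
  ext δ
  simp only [shift, Set.mem_mul, Set.mem_iUnion, Finset.mem_range, exists_prop]
  constructor
  · rintro ⟨σ, ⟨j, hj, hσ⟩, τ, hτ, rfl⟩
    obtain ⟨hc, hs, -⟩ := (D.mem_shiftPart_iff hj).1 hσ
    have hb := D.block_le (n := n) hj
    have hP : 0 ≤ (j : ℤ) * (D.κ : ℤ) ^ n := by positivity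
    obtain ⟨ht1, ht2, ht3⟩ := hτ
    push_cast at ht1 ht3
    refine ⟨?_, ?_, ?_⟩
    · rw [lamps_coe_mul, hc]
      push_cast
      exact mul_mem hs (D.translate_mem_supportedIn ht1 hP (by linarith))
    · rw [cursor_mul, hc]
      omega
    · rw [cursor_mul, hc]
      push_cast
      linarith
  · rintro ⟨h1, h2, h3⟩
    push_cast at h1 h3
    obtain ⟨j, hj⟩ := Int.eq_ofNat_of_zero_le (Int.ediv_nonneg h2 hK.le)
    have hdm := Int.ediv_mul_add_emod (cursor δ) ((D.κ : ℤ) ^ n)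
    have hm1 := Int.emod_nonneg (cursor δ) hK.ne'
    have hm2 := Int.emod_lt_of_pos (cursor δ) hK
    have hjκ : j < D.κ := by
      have : cursor δ / (D.κ : ℤ) ^ n < D.κ :=
        Int.ediv_lt_of_lt_mul hK (by rwa [pow_succ, mul_comm] at h3)
      rw [hj] at this
      exact_mod_cast this
    rw [hj] at hdm
    have hb := D.block_le (n := n) hjκ
    have hP : 0 ≤ (j : ℤ) * (D.κ : ℤ) ^ n := by positivity
    obtain ⟨f, hf, hfK, hfg⟩ := D.exists_restrict (D.κ ^ n) (j * (D.κ : ℤ) ^ n)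
      (D.lamps_coherent δ)
    obtain ⟨τ, hτ, hτf, hτc⟩ := D.exists_mem_box hf hfK hm1 (by push_cast; exact hm2)
    have hc : cursor (δ * τ⁻¹) = j * (D.κ : ℤ) ^ n := by
      rw [cursor_mul, cursor_inv, hτc]
      linarith
    have hl : lamps (δ * τ⁻¹).1 = lamps δ.1 * (translate (j * (D.κ : ℤ) ^ n) f)⁻¹ := by
      rw [lamps_coe_mul, lamps_coe_inv, hτf, hτc, map_inv]
      congr 2
      funext m x
      simp only [translate_apply]
      congr 1
      linarith
    push_cast at hfK hfg
    refine ⟨δ * τ⁻¹, ⟨j, hjκ, (D.mem_shiftPart_iff hjκ).2 ⟨hc, ?_, fun m hm x hx1 hx2 => ?_⟩⟩,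
      τ, hτ, by simp⟩
    · rw [hl]
      exact mul_mem h1 (inv_mem (D.translate_mem_supportedIn hfK hP (by linarith)))
    · rw [hl, Pi.mul_apply, Pi.mul_apply, Pi.inv_apply, Pi.inv_apply, translate_apply,
        hfg m hm x hx1 hx2, mul_inv_cancel]

theorem tile_eq_box (n : ℕ) : tile D.shift n = D.box (D.κ ^ n) := by
  induction n with
  | zero =>
    rw [pow_zero, ← F_one_eq_box]
    rfl
  | succ n ih => rw [tile, ih, shift_mul_box]

theorem finite_shift [Finite A] [Finite B] (n : ℕ) : (D.shift n).Finite := by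
  cases n with
  | zero =>
    change (D.F 1).Finite
    rw [F_one_eq_box]
    exact D.finite_box le_rfl
  | succ n =>
    refine (D.finite_box (D.κ_pow_pos (n + 1))).subset fun σ hσ => ?_
    rw [← shift_mul_box]
    exact ⟨σ, hσ, 1, D.one_mem_box (D.κ_pow_pos n), mul_one σ⟩

theorem shift_pairwiseDisjoint (n : ℕ) :
    (D.shift (n + 1)).PairwiseDisjoint fun σ => σ • D.box (D.κ ^ n) := by
  intro σ hσ σ' hσ' hne
  refine Set.disjoint_left.2 ?_
  rintro _ ⟨τ, hτ, rfl⟩ ⟨τ', hτ', h⟩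
  simp only [shift, Set.mem_iUnion, Finset.mem_range, exists_prop] at hσ hσ'
  obtain ⟨i, hi, hσ⟩ := hσ
  obtain ⟨j, hj, hσ'⟩ := hσ'
  exact hne (D.mul_eq_mul_of_mem_shiftPart hi hj hσ hσ' hτ hτ' h.symm)

/-! ### The boundary of the boxes -/

/-- The elements of a box with maximal cursor make up at most the fraction `1/N` of it, since right
multiplication by powers of the generator `(id, 1)` moves the cursor only. -/
theorem mul_ncard_slice_le [Finite A] [Finite B] {N : ℕ} (hN : 1 ≤ N) :
    N * {δ ∈ D.box N | cursor δ = N - 1}.ncard ≤ (D.box N).ncard := by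
  let τ : D.Delta := ⟨genT, Subgroup.subset_closure D.genT_mem⟩
  have hτl : ∀ i : ℕ, lamps (τ ^ i).1 = 1 ∧ cursor (τ ^ i) = i := by
    intro i
    have : (τ ^ i).1 = config 1 i := (config_one_natCast i).symm
    exact ⟨by rw [this, lamps_config], by rw [cursor, this]; rfl⟩
  have hinj : Set.InjOn (fun p : ℕ × D.Delta => p.2 * (τ ^ p.1)⁻¹)
      (Set.Iio N ×ˢ {δ ∈ D.box N | cursor δ = N - 1}) := by
    rintro ⟨i, δ⟩ ⟨-, -, hδ⟩ ⟨j, ε⟩ ⟨-, -, hε⟩ h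
    have hc := congrArg cursor h
    simp only [cursor_mul, cursor_inv, (hτl _).2] at hc hδ hε
    obtain rfl : i = j := by omega
    obtain rfl : δ = ε := mul_right_cancel h
    rfl
  have hmaps : (fun p : ℕ × D.Delta => p.2 * (τ ^ p.1)⁻¹) ''
      (Set.Iio N ×ˢ {δ ∈ D.box N | cursor δ = N - 1}) ⊆ D.box N := by
    rintro _ ⟨⟨i, δ⟩, ⟨hi, hδ, hc⟩, rfl⟩
    simp only [Set.mem_Iio] at hi hc
    refine ⟨?_, ?_⟩
    · simp only [lamps_coe_mul, lamps_coe_inv, (hτl _).1, map_one, inv_one, mul_one]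
      exact hδ.1
    · simp only [cursor_mul, cursor_inv, (hτl _).2, hc]
      omega
  have h := Set.ncard_le_ncard hmaps (D.finite_box hN)
  rw [hinj.ncard_image, Set.ncard_prod] at h
  simpa using h

theorem ncard_boundary_le [Finite A] [Finite B] {N : ℕ} (hN : 1 ≤ N) {s : D.Delta}
    (hs : s ∈ D.genDelta) :
    N * ((D.box N * {s}) \ D.box N).ncard ≤ (D.box N).ncard := by
  have hsub : (D.box N * {s}) \ D.box N ⊆ {δ ∈ D.box N | cursor δ = N - 1} * {s} := by
    intro x hx
    simp only [Set.mul_singleton, Set.mem_sdiff, Set.mem_image] at hx ⊢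
    obtain ⟨⟨δ, hδ, rfl⟩, hx⟩ := hx
    refine ⟨δ, ⟨hδ, ?_⟩, rfl⟩
    by_contra hc
    have h1 : cursor s = 0 ∨ cursor s = 1 := by
      rcases D.mem_genDelta_iff.1 hs with h | ⟨a, h⟩ | ⟨b, h⟩
      · right; rw [cursor, h]; rfl
      · left; rw [cursor, ← h]; rfl
      · left; rw [cursor, ← h]; rfl
    have h2 := hδ.2
    have h3 := cursor_mul δ s
    exact hx (D.mul_letter_mem_box hδ (Or.inl hs) (by omega) (by omega))
  have hfin : {δ ∈ D.box N | cursor δ = N - 1}.Finite := (D.finite_box hN).subset fun _ h => h.1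
  have h := Set.ncard_le_ncard hsub (hfin.mul (Set.finite_singleton s))
  rw [ncard_mul_singleton] at h
  exact (Nat.mul_le_mul_left N h).trans (D.mul_ncard_slice_le hN)

theorem boundary_box_le [Finite A] [Finite B] {N : ℕ} (hN : 1 ≤ N) {s : D.Delta}
    (hs : s ∈ D.genDelta) :
    (((D.box N * {s}) \ D.box N).ncard : ℝ) ≤ 2 / (N : ℝ) * ((D.box N).ncard : ℝ) := by
  have h : (N : ℝ) * ((D.box N * {s}) \ D.box N).ncard ≤ (D.box N).ncard := by
    exact_mod_cast D.ncard_boundary_le hN hs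
  have hN' : (0 : ℝ) < N := by exact_mod_cast hN
  rw [div_mul_eq_mul_div, le_div_iff₀ hN']
  have : (0 : ℝ) ≤ (D.box N).ncard := by positivity
  linarith

theorem closure_genDelta : Subgroup.closure D.genDelta = ⊤ :=
  Subgroup.closure_closure_coe_preimage (k := D.genSet)

theorem isRightFolnerTilingShift [Finite A] [Finite B] :
    IsRightFolnerTilingShift D.shift where
  finite := D.finite_shift
  tile_finite n := by rw [tile_eq_box]; exact D.finite_box (D.κ_pow_pos n)
  tile_nonempty n := by rw [tile_eq_box]; exact ⟨1, D.one_mem_box (D.κ_pow_pos n)⟩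
  folner := by
    have hfin : ∀ n, (tile D.shift n).Finite := fun n => by
      rw [tile_eq_box]; exact D.finite_box (D.κ_pow_pos n)
    refine folner_of_generators D.closure_genDelta hfin fun s hs => ?_
    have hκ : (1 : ℝ) < D.κ := by exact_mod_cast D.two_le_κ
    have hlim : Filter.Tendsto (fun n : ℕ => 2 / (D.κ : ℝ) ^ n) Filter.atTop (nhds 0) :=
      (tendsto_pow_atTop_atTop_of_one_lt hκ).const_div_atTop 2
    refine squeeze_zero (fun n => by positivity) (fun n => ?_) hlim
    rw [tile_eq_box]
    refine div_le_of_le_mul₀ (by positivity) (by positivity) ?_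
    exact_mod_cast D.boundary_box_le (D.κ_pow_pos n) hs
  tile_succ n := by
    rw [tile]
    exact (Set.iUnion_smul_set (D.shift (n + 1)) (tile D.shift n)).symm
  disjoint n := by
    rw [tile_eq_box]
    exact D.shift_pairwiseDisjoint n

end DiagonalProductData

theorem mainTheorem5 {A B : Type*} {Γ : ℕ → Type*} [Group A] [Group B] [∀ m, Group (Γ m)]
    [Finite A] [Finite B] [∀ m, Finite (Γ m)] (D : DiagonalProductData A B Γ) :
    ∃ C_R : ℝ, 0 < C_R ∧
      (∀ n : ℕ, 1 ≤ n → (wordDiam D.genDelta (D.F n) : ENNReal) ≤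
        ENNReal.ofReal (C_R * n * D.l (D.level (n - 1)))) ∧
      IsRightFolnerTilingShiftWith D.genDelta D.shift
        (fun n => C_R * (D.κ : ℝ) ^ n * D.l (D.bigLevel n))
        (fun n => 2 / (D.κ : ℝ) ^ n) := by
  obtain ⟨C, hC, h⟩ := D.exists_hasWordLE_box
  have key : ∀ N : ℕ, 1 ≤ N → ∀ T ⊆ D.box N, (wordDiam D.genDelta T : ENNReal) ≤
      ENNReal.ofReal (C * N * D.l (D.level (N - 1))) := by
    intro N hN T hT
    obtain ⟨n, hn, hw⟩ := h N hN
    have h1 : (wordDiam D.genDelta T : ENNReal) ≤ ((2 * n : ℕ) : ℕ∞) :=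
      ENat.toENNReal_le.2 (wordDiam_le fun δ hδ => hw δ (hT hδ))
    rw [ENat.toENNReal_coe, ← ENNReal.ofReal_natCast] at h1
    exact h1.trans (ENNReal.ofReal_le_ofReal hn)
  refine ⟨C, hC, fun n hn => key n hn _ (D.F_subset_box n), ?_⟩
  exact
    { generating := D.closure_genDelta
      isShift := D.isRightFolnerTilingShift
      diam_le := fun n => by
        have h2 := key (D.κ ^ n) (D.κ_pow_pos n) _ (D.tile_eq_box n).subset
        push_cast at h2
        exact h2
      boundary_le := fun n s hs => by
        rw [D.tile_eq_box]
        exact_mod_cast D.boundary_box_le (D.κ_pow_pos n) hs }
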